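/- **Theorem 5.1 (SGD with tail-averaging, upper bound).** Let $\mathcal H$ be a nonzero real separable Hilbert space (finite or countably infinite dimensional), let $\mathcal D$ be a probability distribution of pairs $(x,y)\in\mathcal H\times\mathbb R$, and put $L(w)=\tfrac12\,\mathbb E_{\mathcal D}[(y-\langle w,x\rangle)^2]$ and $H=\mathbb E[xx^\top]$. Assume: 1. (Regularity) $\mathbb E\|x\|^4<\infty$ and $\mathbb E[y^2]<\infty$ (so $\operatorname{tr}H=\mathbb E\|x\|^2<\infty$), $H$ is strictly positive definite, and $L$ has a unique minimizer $w^*$. 2. (Fourth moment) $\alpha>0$ is such that $\mathbb E[xx^\top A\,xx^\top]\preceq\alpha\operatorname{tr}(HA)\,H$ for every bounded positive semidefinite operator $A$. 3. (Noise) $\Sigma=\mathbb E[(y-\langle w^*,x\rangle)^2xx^\top]$ exists and $\sigma^2=\|H^{-1/2}\Sigma H^{-1/2}\|$ (operator norm) is finite. Let $H=\sum_i\lambda_iv_iv_i^\top$ be an eigendecomposition with $\lambda_1\ge\lambda_2\ge\cdots$ and an orthonormal basis $(v_i)$ (if $\dim\mathcal H=d<\infty$, set $\lambda_i=0$ and $v_i=0$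 for $i>d$), and write $$\|w\|^2_{H_{0:k}^{-1}}=\sum_{i\le k}\frac{\langle v_i,w\rangle^2}{\lambda_i},\qquad \|w\|^2_{H_{k:\infty}}=\sum_{i>k}\lambda_i\langle v_i,w\rangle^2 .$$ Let $0<\gamma\le 1/(\alpha\operatorname{tr}H)$, let $s\ge0$ and $N\ge1$ be integers, let $w_0\in\mathcal H$, let $(x_t,y_t)_{t\ge1}$ be i.i.d. samples from $\mathcal D$, and let $$w_t=w_{t-1}+\gamma\,(y_t-\langle w_{t-1},x_t\rangle)\,x_t\quad(t\ge1),\qquad \overline w_{s:s+N}=\frac1N\sum_{t=s}^{s+N-1}w_t .$$ Then $L(\overline w_{s:s+N})$ is integrable and $$\mathbb E[L(\overline w_{s:s+N})]-L(w^*)\le 2\cdot\mathrm{EffectiveBias}+2\cdot\mathrm{EffectiveVar},$$ where $$\mathrm{EffectiveBias}=\frac1{\gamma^2N^2}\big\|(I-\gamma H)^s(w_0-w^*)\big\|^2_{H_{0:k^*}^{-1}}+\big\|(I-\gamma H)^s(w_0-w^*)\big\|^2_{H_{k^*:\infty}},$$ $$\mathrm{EffectiveVar}=\frac{2\alpha\gamma\|w_0-w^*\|^2\Big(\frac{k^*}{N^2\gamma^2}+\sum_{i>k^*}\lambda_i^2\Big)}{1-\gamma\alpha\operatorname{tr}H}+\frac{\sigma^2\Big(\frac{k^*}{N}+\gamma\sum_{k^*<i\le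 k^\dagger}\lambda_i+\gamma^2(s+N)\sum_{i>k^\dagger}\lambda_i^2\Big)}{1-\gamma\alpha\operatorname{tr}H},$$ $k^*=\max\{k:\lambda_k\ge\frac1{\gamma N}\}$ and $k^\dagger=\max\{k:\lambda_k\ge\frac1{\gamma(s+N)}\}$, with $\max\emptyset=0$. When $\gamma=1/(\alpha\operatorname{tr}H)$ each of the two fractions of $\mathrm{EffectiveVar}$ is read as $+\infty$ if its numerator is positive and as $0$ if its numerator is $0$. -/

import Mathlib

open MeasureTheory ProbabilityTheory InnerProductSpace
open scoped ENNReal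

namespace SGDRegression

noncomputable section

variable {E : Type*} [NormedAddCommGroup E] [InnerProductSpace ℝ E]

/-- The population risk `L(w) = (1/2) 𝔼_{(x, y) ∼ D} (y - ⟨w, x⟩)²`. -/
def risk [MeasurableSpace E] (D : Measure (E × ℝ)) (w : E) : ℝ :=
  (1 / 2) * ∫ p, (p.2 - inner ℝ w p.1) ^ 2 ∂D

/-- The second moment operator `H = 𝔼[x xᵀ]`, a Bochner integral of bounded operators. -/
def secondMoment [MeasurableSpace E] (D : Measure (E × ℝ)) : E →L[ℝ] E :=
  ∫ p, rankOne ℝ p.1 p.1 ∂D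

/-- The operator `𝔼[x xᵀ A x xᵀ]`. -/
def fourthMoment [MeasurableSpace E] (D : Measure (E × ℝ)) (A : E →L[ℝ] E) : E →L[ℝ] E :=
  ∫ p, (rankOne ℝ p.1 p.1) ∘L A ∘L (rankOne ℝ p.1 p.1) ∂D

/-- The covariance `Σ = 𝔼[(y - ⟨w, x⟩)² x xᵀ]` of the gradient noise at `w`. -/
def noiseCov [MeasurableSpace E] (D : Measure (E × ℝ)) (w : E) : E →L[ℝ] E :=
  ∫ p, (p.2 - inner ℝ w p.1) ^ 2 • rankOne ℝ p.1 p.1 ∂D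

/-- The trace of a (trace class) operator: the sum of its diagonal entries in a Hilbert basis.
For trace class operators, the sum converges absolutely and does not depend on the basis. -/
def opTrace [CompleteSpace E] (T : E →L[ℝ] E) : ℝ :=
  ∑' i, inner ℝ ((exists_hilbertBasis ℝ E).choose_spec.choose i)
    (T ((exists_hilbertBasis ℝ E).choose_spec.choose i))

/-- Regularity conditions: `x` has a finite fourth moment, `y` has a finite second moment, `H` is
strictly positive definite and `wstar` is the unique minimizer of the risk.
(`‖x ⊗ x ⊗ x ⊗ x‖ = ‖x‖⁴`, and `tr H = 𝔼‖x‖²` is finite as soon as `𝔼‖x‖⁴` is.) -/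
structure RegularityConditions [MeasurableSpace E] (D : Measure (E × ℝ)) (wstar : E) : Prop where
  memLp_fst : MemLp (fun p : E × ℝ => p.1) 4 D
  memLp_snd : MemLp (fun p : E × ℝ => p.2) 2 D
  posDef : ∀ w : E, w ≠ 0 → 0 < inner ℝ w (secondMoment D w)
  minimizer : ∀ w : E, risk D wstar ≤ risk D w
  unique_minimizer : ∀ w : E, (∀ w' : E, risk D w ≤ risk D w') → w = wstar

/-- The fourth moment condition with constant `α > 0`: `𝔼[x xᵀ A x xᵀ] ≼ α tr(H A) H` for all
positive semidefinite bounded operators `A`; here `≤` is the Loewner order. -/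
def FourthMomentCondition [CompleteSpace E] [MeasurableSpace E] (D : Measure (E × ℝ)) (α : ℝ) :
    Prop :=
  0 < α ∧ ∀ A : E →L[ℝ] E, A.IsPositive →
    fourthMoment D A ≤ (α * opTrace (secondMoment D ∘L A)) • secondMoment D

/-- The noise condition: `Σ` exists, `H^{-1/2} Σ H^{-1/2}` is a bounded operator and `σsq` is its
operator norm. Here `R` is the positive square root of `H`, and `T = H^{-1/2} Σ H^{-1/2}` is the
bounded operator (unique when `H` is strictly positive definite) with
`H^{1/2} T H^{1/2} = Σ`. -/
def NoiseCondition [CompleteSpace E] [MeasurableSpace E] (D : Measure (E × ℝ)) (wstar : E)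
    (σsq : ℝ) : Prop :=
  Integrable (fun p : E × ℝ => (p.2 - inner ℝ wstar p.1) ^ 2 • rankOne ℝ p.1 p.1) D ∧
  ∃ R T : E →L[ℝ] E, R.IsPositive ∧ R ∘L R = secondMoment D ∧
    R ∘L T ∘L R = noiseCov D wstar ∧ ‖T‖ = σsq

/-- `H = ∑ λ_i v_i v_iᵀ` with the eigenvalues in non-increasing order and with a complete
orthonormal system of eigenvectors. Indices are shifted: `lam i` and `v i` are the `(i + 1)`-st
eigenvalue and eigenvector. In dimension `d < ∞` both sequences are continued by zeros, so that
the nonzero `v i` are the eigenvectors. -/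
structure IsEigendecomposition (H : E →L[ℝ] E) (lam : ℕ → ℝ) (v : ℕ → E) : Prop where
  antitone : Antitone lam
  eigen : ∀ i, H (v i) = lam i • v i
  orthogonal : ∀ i j, i ≠ j → inner ℝ (v i) (v j) = 0
  normalized : ∀ i, ‖v i‖ = 1 ∨ (v i = 0 ∧ lam i = 0)
  complete : (Submodule.span ℝ (Set.range v)).topologicalClosure = ⊤

/-- `max {k ≥ 1 : λ_k ≥ θ}`, and `0` if there is no such `k` (the `k`-th eigenvalue is
`lam (k - 1)`). -/
def cutoff (lam : ℕ → ℝ) (θ : ℝ) : ℕ := sSup {k : ℕ | 1 ≤ k ∧ θ ≤ lam (k - 1)}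

/-- `‖w‖²` in the norm of `H_{0:k}⁻¹`: the sum of `⟨v_i, w⟩² / λ_i` over the first `k` indices. -/
def headInvNormSq (lam : ℕ → ℝ) (v : ℕ → E) (k : ℕ) (w : E) : ℝ :=
  ∑ i ∈ Finset.range k, (inner ℝ (v i) w) ^ 2 / lam i

/-- `‖w‖²` in the norm of `H_{k:∞}`: the sum of `λ_i ⟨v_i, w⟩²` over all but the first `k`
indices. -/
def tailNormSq (lam : ℕ → ℝ) (v : ℕ → E) (k : ℕ) (w : E) : ℝ :=
  ∑' j, lam (k + j) * (inner ℝ (v (k + j)) w) ^ 2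

/-- The SGD iterates; the `(t + 1)`-st example is `z t = (x, y)`. -/
def sgd {Ω : Type*} (γ : ℝ) (w₀ : E) (z : ℕ → Ω → E × ℝ) : ℕ → Ω → E
  | 0, _ => w₀
  | t + 1, ω => sgd γ w₀ z t ω +
      (γ * ((z t ω).2 - inner ℝ (sgd γ w₀ z t ω) (z t ω).1)) • (z t ω).1

/-- The average of the `N` iterates `w_s, …, w_{s+N-1}`. -/
def tailAverage {Ω : Type*} (γ : ℝ) (w₀ : E) (z : ℕ → Ω → E × ℝ) (s N : ℕ) (ω : Ω) : E :=
  (1 / (N : ℝ)) • ∑ t ∈ Finset.Ico s (s + N), sgd γ w₀ z t ω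

/-- The effective bias of tail-averaged SGD, for `Δ = w₀ - wstar`. -/
def effectiveBias (H : E →L[ℝ] E) (lam : ℕ → ℝ) (v : ℕ → E) (γ : ℝ) (s N : ℕ) (Δ : E) : ℝ :=
  let kstar := cutoff lam (1 / (γ * N))
  1 / (γ ^ 2 * (N : ℝ) ^ 2) * headInvNormSq lam v kstar (((1 - γ • H) ^ s) Δ)
    + tailNormSq lam v kstar (((1 - γ • H) ^ s) Δ)

/-- The effective variance of tail-averaged SGD, for `Δ = w₀ - wstar`. It is an extended
nonnegative number: at the largest stepsize `γ = 1 / (α tr H)` the denominators vanish, and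
then `c / 0 = ∞` for `c > 0` and `0 / 0 = 0`. -/
def effectiveVar [CompleteSpace E] (H : E →L[ℝ] E) (lam : ℕ → ℝ) (α σsq γ : ℝ) (s N : ℕ)
    (Δ : E) : ℝ≥0∞ :=
  let kstar := cutoff lam (1 / (γ * N))
  let kdag := cutoff lam (1 / (γ * ((s : ℝ) + N)))
  ENNReal.ofReal (2 * α * γ * ‖Δ‖ ^ 2 *
      (kstar / ((N : ℝ) ^ 2 * γ ^ 2) + ∑' j, lam (kstar + j) ^ 2))
      / ENNReal.ofReal (1 - γ * α * opTrace H)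
    + ENNReal.ofReal (σsq *
      (kstar / (N : ℝ) + γ * ∑ i ∈ Finset.Ico kstar kdag, lam i
        + γ ^ 2 * ((s : ℝ) + N) * ∑' j, lam (kdag + j) ^ 2))
      / ENNReal.ofReal (1 - γ * α * opTrace H)

end

end SGDRegression

namespace SGDRegression

/-! ### Scalar inequalities: geometric correlations and perturbed recursions. -/

section Sequences

/-! The error `w_t - w*` is a sum of two SGD runs on the same inputs: a bias run, started at `w₀ -
w*` with the noise `ξ = y - ⟨w*, x⟩` removed, and a variance run, started at 0 with noise `ξ`
(`sgd_sub_eq`). The risk is quadratic around `w*`, so the excess risk is at most the sum of `E⟨u, H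
u⟩` over the two averages `u`.

Each quadratic form is then bounded one eigencoordinate at a time. Given the past, coordinate `i`
contracts in mean by `1 - γλ_i` per step, so correlations inside the window decay geometrically.
Hence `λ_i E⟨v_i, u⟩²` is at most `2/(γN²) · (1 - (1 - γλ_i)^N)` times the window sum of the second
moments `q_i(t)` (`eigenvalue_mul_integral_sq_tailAverage_le`). The bound `1 - (1 - γλ)^N ≤ min(1,
Nγλ)` explains the cutoff at `1/(γN)`.

The `q_i` satisfy `q_i(t+1) ≤ (1 - γλ_i)² q_i(t) + γ²λ_i (α E⟨w_t, H w_t⟩ + σ²)`, where coordinates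
interact only through `E⟨w_t, H w_t⟩`. For the variance run, any `c ≥ 0` with `c γα tr H + γσ² ≤ c`
gives `q_i(t) ≤ c · min(1, γλ_i t)`, whence the second cutoff (`integral_sq_sgd_of_zero_le`). For
the bias run, `E‖w_t‖²` drops by at least `γ E⟨w_t, H w_t⟩` per step, so coordinate `i` receives a
total input of at most `γαλ_i ‖w₀ - w*‖²` (`sum_integral_quadratic_sgd_le`). -/

lemma one_sub_pow_le_one {r : ℝ} (h0 : 0 ≤ r) (n : ℕ) : 1 - r ^ n ≤ 1 := by
  have := pow_nonneg h0 n
  linarith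

lemma one_sub_pow_le_mul {r : ℝ} (h0 : 0 ≤ r) (n : ℕ) : 1 - r ^ n ≤ n * (1 - r) := by
  have := one_add_mul_le_pow (a := r - 1) (by linarith) n
  have h : 1 + (r - 1) = r := by ring
  rw [h] at this
  linarith

lemma one_sub_mul_sum_geometric_shift (r : ℝ) (t n : ℕ) :
    (1 - r) * ∑ k ∈ Finset.Ico t (t + n), r ^ (k - t) = 1 - r ^ n := by
  rw [Finset.sum_Ico_eq_sum_range, Nat.add_sub_cancel_left]
  simp only [Nat.add_sub_cancel_left]
  rw [mul_comm, geom_sum_mul_neg]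

/-- A double sum with geometrically decaying correlations. -/
lemma mul_sum_sum_correlation_le {r : ℝ} (h0 : 0 ≤ r) (h1 : r ≤ 1) {q : ℕ → ℝ}
    (hq : ∀ t, 0 ≤ q t) {K : ℕ → ℕ → ℝ} (hsymm : ∀ t k, K t k = K k t)
    (hK : ∀ t n, K (t + n) t = r ^ n * q t) (s N : ℕ) :
    (1 - r) * ∑ t ∈ Finset.Ico s (s + N), ∑ k ∈ Finset.Ico s (s + N), K t k
      ≤ 2 * (1 - r ^ N) * ∑ t ∈ Finset.Ico s (s + N), q t := by
  set I := Finset.Ico s (s + N)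
  -- `F` keeps the half `t ≤ k` of the square. Both halves contain the diagonal, which is therefore
  -- counted twice; this only enlarges the bound.
  let F : ℕ → ℕ → ℝ := fun t k => if t ≤ k then r ^ (k - t) * q t else 0
  have hF : ∀ t k, 0 ≤ F t k := fun t k => by
    by_cases h : t ≤ k
    · simpa [F, h] using mul_nonneg (pow_nonneg h0 _) (hq t)
    · simp [F, h]
  have hKF : ∀ t k, K t k ≤ F t k + F k t := by
    intro t k
    rcases le_total t k with h | h
    · have : K t k = F t k := by
        obtain ⟨n, rfl⟩ := Nat.exists_eq_add_of_le h
        rw [hsymm, hK]; simp [F]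
      linarith [hF k t]
    · have : K t k = F k t := by
        obtain ⟨n, rfl⟩ := Nat.exists_eq_add_of_le h
        rw [hK]; simp [F]
      linarith [hF t k]
  have hrow : ∀ t ∈ I, (1 - r) * ∑ k ∈ I, F t k ≤ (1 - r ^ N) * q t := by
    intro t ht
    obtain ⟨hst, htN⟩ := Finset.mem_Ico.1 ht
    obtain ⟨m, hm⟩ := Nat.exists_eq_add_of_le htN.le
    have hsum : ∑ k ∈ I, F t k = ∑ k ∈ Finset.Ico t (t + m), r ^ (k - t) * q t := by
      rw [← Finset.sum_filter]
      congr 1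
      ext k
      simp only [I, Finset.mem_filter, Finset.mem_Ico]
      omega
    rw [hsum, ← Finset.sum_mul, ← mul_assoc, one_sub_mul_sum_geometric_shift]
    have : r ^ N ≤ r ^ m := pow_le_pow_of_le_one h0 h1 (by omega)
    exact mul_le_mul_of_nonneg_right (by linarith) (hq t)
  have h1r : 0 ≤ 1 - r := by linarith
  calc (1 - r) * ∑ t ∈ I, ∑ k ∈ I, K t k
      ≤ (1 - r) * ∑ t ∈ I, ∑ k ∈ I, (F t k + F k t) :=
        mul_le_mul_of_nonneg_left
          (Finset.sum_le_sum fun t _ => Finset.sum_le_sum fun k _ => hKF t k) h1r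
    _ = 2 * ∑ t ∈ I, (1 - r) * ∑ k ∈ I, F t k := by
        simp only [Finset.sum_add_distrib]
        rw [Finset.sum_comm (f := fun t k => F k t), ← Finset.mul_sum]
        ring
    _ ≤ 2 * ∑ t ∈ I, (1 - r ^ N) * q t :=
        mul_le_mul_of_nonneg_left (Finset.sum_le_sum hrow) (by norm_num)
    _ = 2 * (1 - r ^ N) * ∑ t ∈ I, q t := by rw [← Finset.mul_sum]; ring

/-- The decay of past perturbations is discarded, since only their total is controlled later. -/
lemma le_pow_mul_add_sum_of_recursion {ρ : ℝ} (h0 : 0 ≤ ρ) (h1 : ρ ≤ 1) {q g : ℕ → ℝ}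
    (hg : ∀ t, 0 ≤ g t) (h : ∀ t, q (t + 1) ≤ ρ * q t + g t) (t : ℕ) :
    q t ≤ ρ ^ t * q 0 + ∑ u ∈ Finset.range t, g u := by
  induction t with
  | zero => simp
  | succ t ih =>
    have hs : 0 ≤ ∑ u ∈ Finset.range t, g u := Finset.sum_nonneg fun u _ => hg u
    have := mul_le_mul_of_nonneg_left ih h0
    rw [Finset.sum_range_succ, pow_succ]
    nlinarith [h t]

/-- Summing the recursion over the window telescopes; this yields a bound free of the factor `N`. -/
lemma one_sub_mul_sum_le_of_recursion {ρ : ℝ} {q g : ℕ → ℝ}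
    (h : ∀ t, q (t + 1) ≤ ρ * q t + g t) (s N : ℕ) :
    (1 - ρ) * ∑ t ∈ Finset.Ico s (s + N), q t + q (s + N)
      ≤ q s + ∑ t ∈ Finset.Ico s (s + N), g t := by
  induction N with
  | zero => simp
  | succ N ih =>
    rw [← add_assoc, Finset.sum_Ico_succ_top (by omega), Finset.sum_Ico_succ_top (by omega)]
    linarith [h (s + N)]

/-- The two bounds for the sum of a window of `q`, for a contraction `q` with the summable
perturbation `g`. -/
lemma window_le_of_recursion {r T : ℝ} (h0 : 0 ≤ r) (h1 : r ≤ 1) {q g : ℕ → ℝ}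
    (hq : ∀ t, 0 ≤ q t) (hg : ∀ t, 0 ≤ g t) (h : ∀ t, q (t + 1) ≤ r ^ 2 * q t + g t)
    (hT : ∀ t, ∑ u ∈ Finset.range t, g u ≤ T) (s N : ℕ) :
    ∑ t ∈ Finset.Ico s (s + N), q t ≤ N * ((r ^ s) ^ 2 * q 0 + T) ∧
    (1 - r) * ∑ t ∈ Finset.Ico s (s + N), q t ≤ (r ^ s) ^ 2 * q 0 + T := by
  have hr2 : r ^ 2 ≤ 1 := pow_le_one₀ h0 h1
  have hle := le_pow_mul_add_sum_of_recursion (sq_nonneg r) hr2 hg h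
  have hpow : ∀ t, (r ^ 2) ^ t = (r ^ t) ^ 2 := fun t => by rw [← pow_mul, ← pow_mul, mul_comm]
  constructor
  · have : ∀ t ∈ Finset.Ico s (s + N), q t ≤ (r ^ s) ^ 2 * q 0 + T := by
      intro t ht
      have hst := (Finset.mem_Ico.1 ht).1
      have h2 : (r ^ 2) ^ t ≤ (r ^ s) ^ 2 := by
        rw [← hpow]; exact pow_le_pow_of_le_one (sq_nonneg r) hr2 hst
      linarith [hle t, hT t, mul_le_mul_of_nonneg_right h2 (hq 0)]
    have := Finset.sum_le_card_nsmul _ _ _ this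
    rwa [nsmul_eq_mul, Nat.card_Ico, Nat.add_sub_cancel_left] at this
  · have h3 := one_sub_mul_sum_le_of_recursion h s N
    have h4 : 0 ≤ ∑ t ∈ Finset.Ico s (s + N), q t := Finset.sum_nonneg fun t _ => hq t
    have h5 : (1 - r) * ∑ t ∈ Finset.Ico s (s + N), q t
        ≤ (1 - r ^ 2) * ∑ t ∈ Finset.Ico s (s + N), q t :=
      mul_le_mul_of_nonneg_right (by nlinarith) h4
    -- The perturbations before the window, contained in `q s`, and those inside it form one sum, so
    -- `T` is paid only once.
    have h6 : ∑ u ∈ Finset.range s, g u + ∑ t ∈ Finset.Ico s (s + N), g t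
        = ∑ u ∈ Finset.range (s + N), g u := Finset.sum_range_add_sum_Ico _ (by omega)
    have h7 := hle s
    rw [hpow] at h7
    linarith [hT (s + N), hq (s + N)]

end Sequences

/-! ### Parseval's identity in the zero-padded eigenbasis. -/

section Eigen

variable {E : Type*} [NormedAddCommGroup E] [InnerProductSpace ℝ E] [CompleteSpace E]

/-- The nonzero `v i` form a Hilbert basis; the padding vectors contribute zero terms. -/
lemma IsEigendecomposition.hasSum_inner_mul_inner {H : E →L[ℝ] E} {lam : ℕ → ℝ} {v : ℕ → E}
    (h : IsEigendecomposition H lam v) (x y : E) :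
    HasSum (fun i => inner ℝ x (v i) * inner ℝ (v i) y) (inner ℝ x y) := by
  let S : Set ℕ := {i | v i ≠ 0}
  let u : S → E := fun i => v i
  have hu : Orthonormal ℝ u := by
    refine ⟨fun i => ?_, fun i j hij => h.orthogonal _ _ fun h' => hij (Subtype.ext h')⟩
    rcases h.normalized i with h1 | h1
    · exact h1
    · exact absurd h1.1 i.2
  have hspan : Submodule.span ℝ (Set.range u) = Submodule.span ℝ (Set.range v) := by
    refine le_antisymm (Submodule.span_mono ?_) (Submodule.span_le.2 ?_)
    · rintro _ ⟨i, rfl⟩; exact ⟨i, rfl⟩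
    · rintro _ ⟨i, rfl⟩
      by_cases hi : v i = 0
      · rw [hi]; exact Submodule.zero_mem _
      · exact Submodule.subset_span ⟨⟨i, hi⟩, rfl⟩
  let b := HilbertBasis.mk hu (by rw [hspan, h.complete])
  have hb : ∀ i, b i = v i := fun i => by rw [HilbertBasis.coe_mk]
  have key := b.hasSum_inner_mul_inner x y
  simp only [hb] at key
  refine (hasSum_subtype_iff_of_support_subset (s := S) ?_).1 key
  intro i hi h0
  exact hi (by simp [h0])

lemma IsEigendecomposition.hasSum_sq_inner {H : E →L[ℝ] E} {lam : ℕ → ℝ} {v : ℕ → E}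
    (h : IsEigendecomposition H lam v) (x : E) :
    HasSum (fun i => inner ℝ (v i) x ^ 2) (‖x‖ ^ 2) := by
  have := h.hasSum_inner_mul_inner x x
  rw [real_inner_self_eq_norm_sq] at this
  convert! this using 2 with i
  rw [sq, real_inner_comm]

end Eigen

/-! ### Eigenvalues on either side of a cutoff. -/

section Cutoff

variable {lam : ℕ → ℝ} {θ : ℝ}

/-- Boundedness matters because `sSup` of an unbounded set of naturals is 0, which would make the
cutoff meaningless. -/
lemma bddAbove_cutoff_set (h : Summable lam) (hθ : 0 < θ) :
    BddAbove {k : ℕ | 1 ≤ k ∧ θ ≤ lam (k - 1)} := by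
  have h1 : ∀ᶠ n in Filter.atTop, lam n < θ := h.tendsto_atTop_zero.eventually_lt_const hθ
  obtain ⟨n, hn⟩ := Filter.eventually_atTop.1 h1
  refine ⟨n, fun k hk => ?_⟩
  by_contra hkn
  exact absurd (hn (k - 1) (by omega)) (not_lt.2 hk.2)

lemma le_of_lt_cutoff (ha : Antitone lam) {i : ℕ} (hi : i < cutoff lam θ) : θ ≤ lam i := by
  have hne : {k : ℕ | 1 ≤ k ∧ θ ≤ lam (k - 1)}.Nonempty := by
    by_contra h0
    rw [Set.not_nonempty_iff_eq_empty] at h0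
    simp [cutoff, h0] at hi
  by_cases hb : BddAbove {k : ℕ | 1 ≤ k ∧ θ ≤ lam (k - 1)}
  · have := Nat.sSup_mem hne hb
    exact this.2.trans (ha (by unfold cutoff at hi; omega))
  · rw [cutoff, Nat.sSup_of_not_bddAbove hb] at hi
    omega

lemma lt_of_cutoff_le (h : Summable lam) (hθ : 0 < θ) {i : ℕ} (hi : cutoff lam θ ≤ i) :
    lam i < θ := by
  by_contra hlt
  have := le_csSup (bddAbove_cutoff_set h hθ) (a := i + 1) ⟨by omega, by simpa using hlt⟩
  unfold cutoff at hi
  omega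

lemma cutoff_anti (ha : Antitone lam) (h : Summable lam) {θ' : ℝ} (hθ : 0 < θ) (hle : θ ≤ θ') :
    cutoff lam θ' ≤ cutoff lam θ := by
  by_contra hlt
  push Not at hlt
  have h1 := le_of_lt_cutoff ha hlt
  have h2 := lt_of_cutoff_le h hθ (le_refl (cutoff lam θ))
  linarith

end Cutoff

end SGDRegression

set_option linter.unusedSectionVars false

/-! ### The centered model and the moments of a single step. -/

namespace SGDRegression

/-- Nonnegative terms dominate themselves, and their sum `F` is integrable. -/
lemma hasSum_integral_of_nonneg {Ω : Type*} [MeasurableSpace Ω] {P : Measure Ω}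
    {f : ℕ → Ω → ℝ} {F : Ω → ℝ} (hf : ∀ i, AEStronglyMeasurable (f i) P)
    (h0 : ∀ i ω, 0 ≤ f i ω) (hs : ∀ ω, HasSum (fun i => f i ω) (F ω)) (hF : Integrable F P) :
    HasSum (fun i => ∫ ω, f i ω ∂P) (∫ ω, F ω ∂P) := by
  refine hasSum_integral_of_dominated_convergence f hf
    (fun i => .of_forall fun ω => by rw [Real.norm_of_nonneg (h0 i ω)])
    (.of_forall fun ω => (hs ω).summable) ?_ (.of_forall hs)
  simpa only [(hs _).tsum_eq] using hF

variable {E : Type*} [NormedAddCommGroup E] [InnerProductSpace ℝ E]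

/-- Least squares data `(x, ξ)` whose risk is minimal at `0`, together with the moment bounds
along an eigenbasis of `H = 𝔼[x xᵀ]` that the analysis of stochastic gradient descent uses. -/
structure CenteredModel [MeasurableSpace E] (D : Measure (E × ℝ)) (H : E →L[ℝ] E) (lam : ℕ → ℝ)
    (v : ℕ → E) (α σsq : ℝ) : Prop where
  memLp_fst : MemLp (fun p : E × ℝ => p.1) 4 D
  memLp_smul : MemLp (fun p : E × ℝ => p.2 • p.1) 2 D
  eigen : IsEigendecomposition H lam v
  second_moment : ∀ u w, ∫ p, inner ℝ u p.1 * inner ℝ w p.1 ∂D = inner ℝ u (H w)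
  noise_mean : ∀ u, ∫ p, p.2 * inner ℝ u p.1 ∂D = 0
  fourth_moment : ∀ i e, ∫ p, (inner ℝ e p.1 * inner ℝ (v i) p.1) ^ 2 ∂D
    ≤ α * lam i * inner ℝ e (H e)
  noise_cov : ∀ i, ∫ p, (p.2 * inner ℝ (v i) p.1) ^ 2 ∂D ≤ σsq * lam i

namespace CenteredModel

variable [CompleteSpace E] [SecondCountableTopology E] [MeasurableSpace E] [BorelSpace E]
  {D : Measure (E × ℝ)} {H : E →L[ℝ] E} {lam : ℕ → ℝ} {v : ℕ → E} {α σsq : ℝ}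

lemma integrable_norm_pow_four (h : CenteredModel D H lam v α σsq) :
    Integrable (fun p : E × ℝ => ‖p.1‖ ^ 4) D := by
  have := h.memLp_fst.integrable_norm_pow (by norm_num)
  simpa using this

variable [IsProbabilityMeasure D]

lemma memLp_two_fst (h : CenteredModel D H lam v α σsq) :
    MemLp (fun p : E × ℝ => p.1) 2 D := h.memLp_fst.mono_exponent (by norm_num)

lemma integrable_norm_sq (h : CenteredModel D H lam v α σsq) :
    Integrable (fun p : E × ℝ => ‖p.1‖ ^ 2) D := h.memLp_two_fst.integrable_norm_pow two_ne_zero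

lemma memLp_inner (h : CenteredModel D H lam v α σsq) (u : E) :
    MemLp (fun p : E × ℝ => inner ℝ u p.1) 2 D := h.memLp_two_fst.const_inner u

lemma memLp_inner_mul_inner (h : CenteredModel D H lam v α σsq) (u w : E) :
    MemLp (fun p : E × ℝ => inner ℝ u p.1 * inner ℝ w p.1) 2 D := by
  have hm : AEStronglyMeasurable (fun p : E × ℝ => inner ℝ u p.1 * inner ℝ w p.1) D :=
    Continuous.aestronglyMeasurable (by fun_prop)
  rw [memLp_two_iff_integrable_sq hm]
  refine (h.integrable_norm_pow_four.const_mul (‖u‖ ^ 2 * ‖w‖ ^ 2)).mono' (hm.pow 2)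
    (.of_forall fun p => ?_)
  rw [Real.norm_of_nonneg (sq_nonneg _), mul_pow]
  have h1 := sq_le_sq' (neg_le_of_abs_le (abs_real_inner_le_norm u p.1)) (real_inner_le_norm u p.1)
  have h2 := sq_le_sq' (neg_le_of_abs_le (abs_real_inner_le_norm w p.1)) (real_inner_le_norm w p.1)
  calc _ ≤ (‖u‖ * ‖p.1‖) ^ 2 * (‖w‖ * ‖p.1‖) ^ 2 := by gcongr
    _ = _ := by ring

lemma memLp_mul_inner (h : CenteredModel D H lam v α σsq) (u : E) :
    MemLp (fun p : E × ℝ => p.2 * inner ℝ u p.1) 2 D := by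
  simpa [inner_smul_right] using h.memLp_smul.const_inner (𝕜 := ℝ) u

lemma inner_map_comm (h : CenteredModel D H lam v α σsq) (u w : E) :
    inner ℝ u (H w) = inner ℝ (H u) w := by
  rw [real_inner_comm w (H u), ← h.second_moment, ← h.second_moment]
  simp only [mul_comm]

lemma inner_eigenvector_map (h : CenteredModel D H lam v α σsq) (i : ℕ) (u : E) :
    inner ℝ (v i) (H u) = lam i * inner ℝ (v i) u := by
  rw [h.inner_map_comm, h.eigen.eigen, inner_smul_left]; simp

lemma integral_sq_inner_eigenvector (h : CenteredModel D H lam v α σsq) (i : ℕ) :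
    ∫ p, inner ℝ (v i) p.1 ^ 2 ∂D = lam i := by
  simp only [sq]
  rw [h.second_moment, h.inner_eigenvector_map, real_inner_self_eq_norm_sq]
  rcases h.eigen.normalized i with h1 | h1 <;> simp [h1]

lemma eigenvalue_nonneg (h : CenteredModel D H lam v α σsq) (i : ℕ) : 0 ≤ lam i := by
  rw [← h.integral_sq_inner_eigenvector]
  exact integral_nonneg fun p => sq_nonneg _

lemma hasSum_eigenvalue (h : CenteredModel D H lam v α σsq) :
    HasSum lam (∫ p, ‖p.1‖ ^ 2 ∂D) := by
  have := hasSum_integral_of_nonneg (P := D) (f := fun i p => inner ℝ (v i) p.1 ^ 2)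
    (fun i => Continuous.aestronglyMeasurable (by fun_prop)) (fun i p => sq_nonneg _)
    (fun p => h.eigen.hasSum_sq_inner p.1) h.integrable_norm_sq
  simpa only [h.integral_sq_inner_eigenvector] using this

lemma hasSum_quadratic (h : CenteredModel D H lam v α σsq) (u : E) :
    HasSum (fun i => lam i * inner ℝ (v i) u ^ 2) (inner ℝ u (H u)) := by
  convert! h.eigen.hasSum_inner_mul_inner u (H u) using 2 with i
  rw [h.inner_eigenvector_map, real_inner_comm u (v i)]
  ring

lemma quadratic_nonneg (h : CenteredModel D H lam v α σsq) (u : E) : 0 ≤ inner ℝ u (H u) := by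
  rw [← h.second_moment]
  exact integral_nonneg fun p => mul_self_nonneg _

/-- The difference of the two sides is the quadratic form at `a - b`. -/
lemma quadratic_add_le (h : CenteredModel D H lam v α σsq) (a b : E) :
    inner ℝ (a + b) (H (a + b)) ≤ 2 * inner ℝ a (H a) + 2 * inner ℝ b (H b) := by
  have := h.quadratic_nonneg (a - b)
  simp only [map_add, map_sub, inner_add_left, inner_add_right, inner_sub_left,
    inner_sub_right] at *
  linarith

/-- The mean of the squared `i`-th coordinate after a step from `e`, with the term that is linear
in `e` kept. -/
lemma integral_sq_step_le (h : CenteredModel D H lam v α σsq) (γ : ℝ) (i : ℕ) (e : E) :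
    ∫ p, inner ℝ (v i) (e + (γ * (p.2 - inner ℝ e p.1)) • p.1) ^ 2 ∂D
      ≤ (1 - 2 * γ * lam i) * inner ℝ (v i) e ^ 2
        + γ ^ 2 * lam i * (α * inner ℝ e (H e) + σsq)
        - 2 * γ ^ 2 * ∫ p, p.2 * inner ℝ (v i) p.1 * (inner ℝ e p.1 * inner ℝ (v i) p.1) ∂D := by
  have hA := h.memLp_inner_mul_inner e (v i)
  have hB := h.memLp_mul_inner (v i)
  have hAB := hB.integrable_mul hA
  have iA := hA.integrable one_le_two
  have iB := hB.integrable one_le_two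
  -- The noise may depend on `x`, so the mixed term (noise times `e`) need not vanish for fixed `e`.
  -- It is linear in `e` and disappears only after averaging over the iterate.
  have hc : ∀ p : E × ℝ, inner ℝ (v i) (e + (γ * (p.2 - inner ℝ e p.1)) • p.1) ^ 2
      = inner ℝ (v i) e ^ 2 + 2 * γ * inner ℝ (v i) e * (p.2 * inner ℝ (v i) p.1)
        + -(2 * γ * inner ℝ (v i) e) * (inner ℝ e p.1 * inner ℝ (v i) p.1)
        + γ ^ 2 * (p.2 * inner ℝ (v i) p.1) ^ 2
        + -(2 * γ ^ 2) * (p.2 * inner ℝ (v i) p.1 * (inner ℝ e p.1 * inner ℝ (v i) p.1))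
        + γ ^ 2 * (inner ℝ e p.1 * inner ℝ (v i) p.1) ^ 2 := by
    intro p
    rw [inner_add_right, inner_smul_right]
    ring
  simp only [hc]
  have i1 := integrable_const (μ := D) (inner ℝ (v i) e ^ 2)
  have i2 := iB.const_mul (2 * γ * inner ℝ (v i) e)
  have i3 := iA.const_mul (-(2 * γ * inner ℝ (v i) e))
  have i4 := hB.integrable_sq.const_mul (γ ^ 2)
  have i5 := hAB.const_mul (-(2 * γ ^ 2))
  have i6 := hA.integrable_sq.const_mul (γ ^ 2)
  simp only [Pi.mul_apply] at i5
  have j2 := i1.fun_add i2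
  have j3 := j2.fun_add i3
  have j4 := j3.fun_add i4
  have j5 := j4.fun_add i5
  rw [integral_add j5 i6, integral_add j4 i5, integral_add j3 i4, integral_add j2 i3,
    integral_add i1 i2]
  simp only [integral_const_mul, h.noise_mean, h.second_moment, h.eigen.eigen, inner_smul_right]
  have h4 := mul_le_mul_of_nonneg_left (h.fourth_moment i e) (sq_nonneg γ)
  have h5 := mul_le_mul_of_nonneg_left (h.noise_cov i) (sq_nonneg γ)
  rw [real_inner_comm (v i) e]
  simp only [integral_const, probReal_univ, smul_eq_mul]
  linarith

lemma integral_inner_step (h : CenteredModel D H lam v α σsq) (γ : ℝ) (g e : E) :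
    ∫ p, inner ℝ g (e + (γ * (p.2 - inner ℝ e p.1)) • p.1) ∂D = inner ℝ (g - γ • H g) e := by
  have iA := (h.memLp_inner_mul_inner e g).integrable one_le_two
  have iB := (h.memLp_mul_inner g).integrable one_le_two
  have hc : ∀ p : E × ℝ, inner ℝ g (e + (γ * (p.2 - inner ℝ e p.1)) • p.1)
      = inner ℝ g e + γ * (p.2 * inner ℝ g p.1) - γ * (inner ℝ e p.1 * inner ℝ g p.1) := by
    intro p
    rw [inner_add_right, inner_smul_right]
    ring
  simp only [hc]
  rw [integral_sub ((integrable_const _).fun_add (iB.const_mul γ)) (iA.const_mul γ),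
    integral_add (integrable_const _) (iB.const_mul γ)]
  simp only [integral_const_mul, h.noise_mean, h.second_moment]
  rw [real_inner_comm (H g) e, inner_sub_left, inner_smul_left]
  simp

/-- The mixed third moment is a continuous linear functional. -/
lemma exists_integral_mixed_eq_inner (h : CenteredModel D H lam v α σsq) (i : ℕ) :
    ∃ g : E, ∀ e, ∫ p, p.2 * inner ℝ (v i) p.1 * (inner ℝ e p.1 * inner ℝ (v i) p.1) ∂D
      = inner ℝ g e := by
  have hB := h.memLp_mul_inner (v i)
  have hn : MemLp (fun p : E × ℝ => inner ℝ (v i) p.1 • p.1) 2 D := by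
    have hm : AEStronglyMeasurable (fun p : E × ℝ => inner ℝ (v i) p.1 • p.1) D :=
      Continuous.aestronglyMeasurable (by fun_prop)
    rw [memLp_two_iff_integrable_sq_norm hm]
    refine (h.integrable_norm_pow_four.const_mul (‖v i‖ ^ 2)).mono' (hm.norm.pow 2)
      (.of_forall fun p => ?_)
    rw [Real.norm_of_nonneg (sq_nonneg _), norm_smul]
    have h1 := norm_inner_le_norm (𝕜 := ℝ) (v i) p.1
    calc _ ≤ (‖v i‖ * ‖p.1‖ * ‖p.1‖) ^ 2 := by gcongr
      _ = _ := by ring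
  -- The representing vector is the mean of this product of two square integrable functions.
  have hint : Integrable
      (fun p : E × ℝ => (p.2 * inner ℝ (v i) p.1) • (inner ℝ (v i) p.1 • p.1)) D :=
    memLp_one_iff_integrable.1 (hn.smul hB)
  refine ⟨∫ p, (p.2 * inner ℝ (v i) p.1) • (inner ℝ (v i) p.1 • p.1) ∂D, fun e => ?_⟩
  rw [real_inner_comm, ← integral_inner hint]
  congr 1
  ext p
  rw [inner_smul_right, inner_smul_right]
  ring

end CenteredModel

end SGDRegression

/-! ### Moments of the iterates, through independence of past and present. -/

namespace SGDRegression

/-- Fubini's theorem for a function of two independent random variables. -/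
lemma integral_comp_of_indepFun {Ω S T : Type*} [MeasurableSpace Ω] [MeasurableSpace S]
    [MeasurableSpace T] {P : Measure Ω} [IsProbabilityMeasure P] {D : Measure T} {U : Ω → S}
    {Z : Ω → T} (hU : AEMeasurable U P) (hZ : HasLaw Z D P) (hUZ : IndepFun U Z P)
    {φ : S → T → ℝ} (hφ : Measurable fun q : S × T => φ q.1 q.2)
    (hint : Integrable (fun ω => φ (U ω) (Z ω)) P) :
    Integrable (fun ω => ∫ p, φ (U ω) p ∂D) P ∧
      ∫ ω, φ (U ω) (Z ω) ∂P = ∫ ω, ∫ p, φ (U ω) p ∂D ∂P := by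
  have hmap : P.map (fun ω => (U ω, Z ω)) = (P.map U).prod D := by
    rw [← hZ.map_eq]
    exact (indepFun_iff_map_prod_eq_prod_map_map hU hZ.aemeasurable).1 hUZ
  have hpair : AEMeasurable (fun ω => (U ω, Z ω)) P := hU.prodMk hZ.aemeasurable
  have : IsProbabilityMeasure D := hZ.isProbabilityMeasure_iff.1 inferInstance
  have : IsProbabilityMeasure (P.map U) := Measure.isProbabilityMeasure_map hU
  have hφm : AEStronglyMeasurable (fun q : S × T => φ q.1 q.2) (P.map fun ω => (U ω, Z ω)) :=
    hφ.aestronglyMeasurable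
  have h1 : Integrable (fun q : S × T => φ q.1 q.2) ((P.map U).prod D) := by
    rw [← hmap, integrable_map_measure hφm hpair]
    exact hint
  have h2 := h1.integral_prod_left
  refine ⟨h2.comp_aemeasurable hU, ?_⟩
  rw [← integral_map (f := fun s => ∫ p, φ s p ∂D) hU h2.aestronglyMeasurable,
    ← integral_prod _ h1, ← hmap, integral_map hpair hφm]

variable {E : Type*} [NormedAddCommGroup E] [InnerProductSpace ℝ E] [CompleteSpace E]
  [SecondCountableTopology E] [MeasurableSpace E] [BorelSpace E]
  {Ω : Type*} [MeasurableSpace Ω] {P : Measure Ω}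

lemma measurable_sgd (γ : ℝ) (w : E) {z : ℕ → Ω → E × ℝ} {t : ℕ}
    (hz : ∀ i < t, Measurable (z i)) : Measurable (sgd γ w z t) := by
  induction t with
  | zero => exact measurable_const
  | succ t ih =>
    have h1 := ih fun i hi => hz i (by omega)
    have h2 := hz t (by omega)
    change Measurable fun ω => sgd γ w z t ω +
      (γ * ((z t ω).2 - inner ℝ (sgd γ w z t ω) (z t ω).1)) • (z t ω).1
    fun_prop

lemma sgd_congr (γ : ℝ) (w : E) {Ω' : Type*} {z : ℕ → Ω → E × ℝ} {z' : ℕ → Ω' → E × ℝ} {ω : Ω}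
    {ω' : Ω'} {t : ℕ} (h : ∀ i < t, z i ω = z' i ω') : sgd γ w z t ω = sgd γ w z' t ω' := by
  induction t with
  | zero => rfl
  | succ t ih =>
    simp only [sgd]
    rw [ih fun i hi => h i (by omega), h t (by omega)]

variable [IsProbabilityMeasure P] {D : Measure (E × ℝ)} {z : ℕ → Ω → E × ℝ}

lemma aemeasurable_sgd (γ : ℝ) (w : E) (hz : ∀ i, AEMeasurable (z i) P) (t : ℕ) :
    AEMeasurable (sgd γ w z t) P := by
  induction t with
  | zero => exact aemeasurable_const
  | succ t ih =>
    have h2 := hz t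
    change AEMeasurable (fun ω => sgd γ w z t ω +
      (γ * ((z t ω).2 - inner ℝ (sgd γ w z t ω) (z t ω).1)) • (z t ω).1) P
    fun_prop

/-- The iterates up to time `t` are independent of the example used in the step from time `t`. -/
lemma indepFun_sgd (γ : ℝ) (w : E) (hz : ∀ i, AEMeasurable (z i) P) (hindep : iIndepFun z P)
    {t k : ℕ} (hkt : k ≤ t) :
    IndepFun (fun ω => (sgd γ w z t ω, sgd γ w z k ω)) (z t) P := by
  have h := hindep.indepFun_finset₀ (Finset.range t) {t} (by simp) hz
  -- A data stream on the space of the first `t` examples, padded by 0. The padding is never read,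
  -- since `w_t` and `w_k` with `k ≤ t` use only examples before `t`.
  let y : ℕ → (Finset.range t → E × ℝ) → E × ℝ :=
    fun i a => if hi : i ∈ Finset.range t then a ⟨i, hi⟩ else 0
  have hy : ∀ i, Measurable (y i) := by
    intro i
    by_cases hi : i ∈ Finset.range t
    · simp only [y, hi, dite_true]; fun_prop
    · simp only [y, hi, dite_false]; fun_prop
  have hψ : Measurable fun a : ({t} : Finset ℕ) → E × ℝ => a ⟨t, Finset.mem_singleton_self t⟩ :=
    measurable_pi_apply _
  have h2 := h.comp (φ := fun a => (sgd γ w y t a, sgd γ w y k a))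
    ((measurable_sgd γ w fun i _ => hy i).prodMk (measurable_sgd γ w fun i _ => hy i))
    hψ
  convert! h2 using 1
  ext1 ω
  simp only [Function.comp]
  rw [sgd_congr (ω := ω) (z := z) (t := t) (z' := y), sgd_congr (ω := ω) (z := z) (t := k) (z' := y)]
  · intro i hi
    simp [y, show i < t by omega]
  · intro i hi
    simp [y, hi]

namespace CenteredModel

variable [IsProbabilityMeasure D] {H : E →L[ℝ] E} {lam : ℕ → ℝ} {v : ℕ → E} {α σsq : ℝ}

/-- The delicate term is `⟨w_t, x⟩ x`: its squared norm is at most `‖w_t‖² ‖x‖⁴`, a product of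
independent integrable variables. -/
lemma memLp_sgd (h : CenteredModel D H lam v α σsq) (hlaw : ∀ t, HasLaw (z t) D P)
    (hindep : iIndepFun z P) (γ : ℝ) (w : E) (t : ℕ) : MemLp (sgd γ w z t) 2 P := by
  have hz : ∀ i, AEMeasurable (z i) P := fun i => (hlaw i).aemeasurable
  induction t with
  | zero => exact memLp_const w
  | succ t ih =>
    have hs : AEMeasurable (sgd γ w z t) P := aemeasurable_sgd γ w hz t
    have hzt := hz t
    have hind : IndepFun (sgd γ w z t) (z t) P :=
      (indepFun_sgd γ w hz hindep le_rfl).comp (φ := Prod.fst) (ψ := id) measurable_fst measurable_id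
    have hp : ∀ {F : E × ℝ → E}, Continuous F → MemLp F 2 D → MemLp (fun ω => F (z t ω)) 2 P := by
      intro F hF hm
      rw [← (hlaw t).map_eq] at hm
      exact (memLp_map_measure_iff hF.aestronglyMeasurable hzt).1 hm
    have h1 : MemLp (fun ω => (z t ω).2 • (z t ω).1) 2 P :=
      hp (F := fun p => p.2 • p.1) (by fun_prop) h.memLp_smul
    have h2 : MemLp (fun ω => (inner ℝ (sgd γ w z t ω) (z t ω).1) • (z t ω).1) 2 P := by
      have hm : AEStronglyMeasurable
          (fun ω => (inner ℝ (sgd γ w z t ω) (z t ω).1) • (z t ω).1) P :=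
        AEMeasurable.aestronglyMeasurable (by fun_prop)
      rw [memLp_two_iff_integrable_sq_norm hm]
      have h4 : Integrable (fun ω => ‖(z t ω).1‖ ^ 4) P := by
        have := h.integrable_norm_pow_four
        rw [← (hlaw t).map_eq, integrable_map_measure (by fun_prop) hzt] at this
        exact this
      have h6 : Integrable ((fun e => ‖e‖ ^ 2) ∘ sgd γ w z t) P :=
        ih.integrable_norm_pow two_ne_zero
      have h5 := (hind.comp (φ := fun e => ‖e‖ ^ 2) (ψ := fun p : E × ℝ => ‖p.1‖ ^ 4) (by fun_prop)
        (by fun_prop)).integrable_mul h6 h4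
      refine h5.mono' (hm.norm.pow 2) (.of_forall fun ω => ?_)
      rw [Real.norm_of_nonneg (sq_nonneg _), norm_smul]
      have h1 := norm_inner_le_norm (𝕜 := ℝ) (sgd γ w z t ω) (z t ω).1
      calc _ ≤ (‖sgd γ w z t ω‖ * ‖(z t ω).1‖ * ‖(z t ω).1‖) ^ 2 := by gcongr
        _ = _ := by simp only [Pi.mul_apply, Function.comp]; ring
    have h3 : sgd γ w z (t + 1) = fun ω => sgd γ w z t ω + γ • ((z t ω).2 • (z t ω).1)
        - γ • ((inner ℝ (sgd γ w z t ω) (z t ω).1) • (z t ω).1) := by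
      ext1 ω
      simp only [sgd, smul_smul, mul_sub, sub_smul]
      abel
    rw [h3]
    exact (ih.add (h1.const_smul γ)).sub (h2.const_smul γ)

section Moments

variable (h : CenteredModel D H lam v α σsq) (hlaw : ∀ t, HasLaw (z t) D P)
    (hindep : iIndepFun z P) (γ : ℝ) (w : E)

include h hlaw hindep

lemma integrable_inner_sgd (t : ℕ) (g : E) :
    Integrable (fun ω => inner ℝ g (sgd γ w z t ω)) P :=
  ((h.memLp_sgd hlaw hindep γ w t).const_inner g).integrable one_le_two

lemma integrable_sq_inner_sgd (t : ℕ) (g : E) :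
    Integrable (fun ω => inner ℝ g (sgd γ w z t ω) ^ 2) P :=
  ((h.memLp_sgd hlaw hindep γ w t).const_inner g).integrable_sq

lemma integrable_quadratic {U : Ω → E} (hU : MemLp U 2 P) :
    Integrable (fun ω => inner ℝ (U ω) (H (U ω))) P := by
  refine ((hU.integrable_norm_pow two_ne_zero).const_mul ‖H‖).mono' ?_ (.of_forall fun ω => ?_)
  · have := hU.aestronglyMeasurable
    exact this.inner (H.continuous.comp_aestronglyMeasurable this)
  · refine (norm_inner_le_norm (𝕜 := ℝ) _ _).trans ?_
    calc ‖U ω‖ * ‖H (U ω)‖ ≤ ‖U ω‖ * (‖H‖ * ‖U ω‖) := by gcongr; exact H.le_opNorm _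
      _ = _ := by ring

lemma integral_inner_sgd_succ (t : ℕ) (g : E) :
    ∫ ω, inner ℝ g (sgd γ w z (t + 1) ω) ∂P
      = ∫ ω, inner ℝ (g - γ • H g) (sgd γ w z t ω) ∂P := by
  have hz : ∀ i, AEMeasurable (z i) P := fun i => (hlaw i).aemeasurable
  have hind : IndepFun (sgd γ w z t) (z t) P :=
    (indepFun_sgd γ w hz hindep le_rfl).comp (φ := Prod.fst) (ψ := id) measurable_fst measurable_id
  have := (integral_comp_of_indepFun (aemeasurable_sgd γ w hz t) (hlaw t) hind
    (φ := fun e p => inner ℝ g (e + (γ * (p.2 - inner ℝ e p.1)) • p.1)) (by fun_prop)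
    (h.integrable_inner_sgd hlaw hindep γ w (t + 1) g)).2
  simp only [h.integral_inner_step] at this
  exact this

/-- Each step replaces `g` by `(I - γH) g`, so the induction must range over all `g`; the noise adds
nothing to the mean. -/
lemma integral_inner_sgd_of_zero (t : ℕ) (g : E) :
    ∫ ω, inner ℝ g (sgd γ 0 z t ω) ∂P = 0 := by
  induction t generalizing g with
  | zero => simp [sgd]
  | succ t ih => rw [h.integral_inner_sgd_succ hlaw hindep, ih]

/-- The earlier iterate is frozen while the later one is averaged over its newest example; `v i` is
an eigenvector of `I - γH`. -/
lemma integral_mul_inner_sgd (i t n : ℕ) :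
    ∫ ω, inner ℝ (v i) (sgd γ w z (t + n) ω) * inner ℝ (v i) (sgd γ w z t ω) ∂P
      = (1 - γ * lam i) ^ n * ∫ ω, inner ℝ (v i) (sgd γ w z t ω) ^ 2 ∂P := by
  have hz : ∀ i, AEMeasurable (z i) P := fun i => (hlaw i).aemeasurable
  induction n with
  | zero => simp [sq]
  | succ n ih =>
    have hmem := fun t => (h.memLp_sgd hlaw hindep γ w t).const_inner (𝕜 := ℝ) (v i)
    have := (integral_comp_of_indepFun
      ((aemeasurable_sgd γ w hz (t + n)).prodMk (aemeasurable_sgd γ w hz t)) (hlaw (t + n))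
      (indepFun_sgd γ w hz hindep (Nat.le_add_right t n))
      (φ := fun q p => inner ℝ (v i) (q.1 + (γ * (p.2 - inner ℝ q.1 p.1)) • p.1)
        * inner ℝ (v i) q.2) (by fun_prop)
      ((hmem (t + n + 1)).integrable_mul (hmem t))).2
    simp only [integral_mul_const, h.integral_inner_step, h.eigen.eigen, smul_smul] at this
    rw [pow_succ', mul_assoc, ← ih, ← integral_const_mul]
    refine Eq.trans this (integral_congr_ae (.of_forall fun ω => ?_))
    simp only [inner_sub_left, inner_smul_left, conj_trivial]
    ring

/-- The recursion for the second moments of the coordinates of the iterates. -/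
lemma integral_sq_sgd_succ_le (hnoise : w = 0 ∨ ∀ᵐ p ∂D, p.2 = 0) (i t : ℕ) :
    ∫ ω, inner ℝ (v i) (sgd γ w z (t + 1) ω) ^ 2 ∂P
      ≤ (1 - 2 * γ * lam i) * ∫ ω, inner ℝ (v i) (sgd γ w z t ω) ^ 2 ∂P
        + γ ^ 2 * lam i * (α * ∫ ω, inner ℝ (sgd γ w z t ω) (H (sgd γ w z t ω)) ∂P + σsq) := by
  have hz : ∀ i, AEMeasurable (z i) P := fun i => (hlaw i).aemeasurable
  have hind : IndepFun (sgd γ w z t) (z t) P :=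
    (indepFun_sgd γ w hz hindep le_rfl).comp (φ := Prod.fst) (ψ := id) measurable_fst measurable_id
  obtain ⟨hint, heq⟩ := integral_comp_of_indepFun (aemeasurable_sgd γ w hz t) (hlaw t) hind
    (φ := fun e p => inner ℝ (v i) (e + (γ * (p.2 - inner ℝ e p.1)) • p.1) ^ 2) (by fun_prop)
    (h.integrable_sq_inner_sgd hlaw hindep γ w (t + 1) (v i))
  obtain ⟨g, hg⟩ := h.exists_integral_mixed_eq_inner i
  -- The mixed term vanishes for either run: the variance run has mean zero, and the bias run has no
  -- noise.
  have hg0 : ∫ ω, inner ℝ g (sgd γ w z t ω) ∂P = 0 := by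
    rcases hnoise with rfl | h0
    · exact h.integral_inner_sgd_of_zero hlaw hindep γ t g
    · have : ∀ e, inner ℝ g e = 0 := by
        intro e
        rw [← hg]
        refine integral_eq_zero_of_ae ?_
        filter_upwards [h0] with p hp
        simp [hp]
      simp [this]
  have i1 := h.integrable_sq_inner_sgd hlaw hindep γ w t (v i)
  have i2 := h.integrable_quadratic hlaw hindep (h.memLp_sgd hlaw hindep γ w t)
  have i3 := h.integrable_inner_sgd hlaw hindep γ w t g
  have j1 := i1.const_mul (1 - 2 * γ * lam i)
  have j2 := ((i2.const_mul α).fun_add (integrable_const σsq)).const_mul (γ ^ 2 * lam i)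
  have j3 := i3.const_mul (2 * γ ^ 2)
  have hle := fun ω => h.integral_sq_step_le γ i (sgd γ w z t ω)
  simp only [hg] at hle
  refine (heq.trans_le (integral_mono hint ((j1.fun_add j2).sub j3) hle)).trans_eq ?_
  rw [integral_sub' (j1.fun_add j2) j3, integral_add j1 j2]
  simp only [integral_const_mul, hg0]
  rw [integral_add (i2.const_mul α) (integrable_const σsq)]
  simp [integral_const_mul]

lemma hasSum_integral_quadratic {U : Ω → E} (hU : MemLp U 2 P) :
    HasSum (fun i => lam i * ∫ ω, inner ℝ (v i) (U ω) ^ 2 ∂P)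
      (∫ ω, inner ℝ (U ω) (H (U ω)) ∂P) := by
  have := hasSum_integral_of_nonneg (P := P)
    (f := fun i ω => lam i * inner ℝ (v i) (U ω) ^ 2)
    (fun i => (((hU.const_inner (𝕜 := ℝ) (v i)).aestronglyMeasurable.pow 2).const_mul _))
    (fun i ω => mul_nonneg (h.eigenvalue_nonneg i) (sq_nonneg _))
    (fun ω => h.hasSum_quadratic (U ω)) (h.integrable_quadratic hlaw hindep hU)
  simpa only [integral_const_mul] using this

lemma hasSum_integral_sq_inner {U : Ω → E} (hU : MemLp U 2 P) :
    HasSum (fun i => ∫ ω, inner ℝ (v i) (U ω) ^ 2 ∂P) (∫ ω, ‖U ω‖ ^ 2 ∂P) :=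
  hasSum_integral_of_nonneg
    (fun i => ((hU.const_inner (𝕜 := ℝ) (v i)).aestronglyMeasurable.pow 2))
    (fun _ _ => sq_nonneg _) (fun ω => h.eigen.hasSum_sq_inner (U ω))
    (hU.integrable_norm_pow two_ne_zero)

lemma memLp_tailAverage (s N : ℕ) : MemLp (tailAverage γ w z s N) 2 P :=
  (memLp_finsetSum _ fun t _ => h.memLp_sgd hlaw hindep γ w t).const_smul _

/-- The second moment of a coordinate of the average, in terms of those of the iterates. -/
lemma eigenvalue_mul_integral_sq_tailAverage_le (hγ : 0 < γ) {i : ℕ} (hi : γ * lam i ≤ 1)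
    (s N : ℕ) :
    lam i * ∫ ω, inner ℝ (v i) (tailAverage γ w z s N ω) ^ 2 ∂P
      ≤ 2 / (γ * (N : ℝ) ^ 2) * (1 - (1 - γ * lam i) ^ N)
        * ∑ t ∈ Finset.Ico s (s + N), ∫ ω, inner ℝ (v i) (sgd γ w z t ω) ^ 2 ∂P := by
  have hmem := fun t => (h.memLp_sgd hlaw hindep γ w t).const_inner (𝕜 := ℝ) (v i)
  have h0 : 0 ≤ γ * lam i := mul_nonneg hγ.le (h.eigenvalue_nonneg i)
  have key := mul_sum_sum_correlation_le (r := 1 - γ * lam i) (by linarith) (by linarith)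
    (q := fun t => ∫ ω, inner ℝ (v i) (sgd γ w z t ω) ^ 2 ∂P)
    (fun t => integral_nonneg fun ω => sq_nonneg _)
    (K := fun t k => ∫ ω, inner ℝ (v i) (sgd γ w z t ω) * inner ℝ (v i) (sgd γ w z k ω) ∂P)
    (fun t k => by simp only [mul_comm])
    (fun t n => h.integral_mul_inner_sgd hlaw hindep γ w i t n) s N
  have hsq : ∫ ω, inner ℝ (v i) (tailAverage γ w z s N ω) ^ 2 ∂P
      = (1 / (N : ℝ)) ^ 2 * ∑ t ∈ Finset.Ico s (s + N), ∑ k ∈ Finset.Ico s (s + N),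
        ∫ ω, inner ℝ (v i) (sgd γ w z t ω) * inner ℝ (v i) (sgd γ w z k ω) ∂P := by
    have hω : ∀ ω, inner ℝ (v i) (tailAverage γ w z s N ω) ^ 2
        = (1 / (N : ℝ)) ^ 2 * ∑ t ∈ Finset.Ico s (s + N), ∑ k ∈ Finset.Ico s (s + N),
          inner ℝ (v i) (sgd γ w z t ω) * inner ℝ (v i) (sgd γ w z k ω) := by
      intro ω
      rw [tailAverage, inner_smul_right, inner_sum, mul_pow, sq (∑ _ ∈ _, _),
        Finset.sum_mul_sum]
    have hi : ∀ t k, Integrable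
        (fun ω => inner ℝ (v i) (sgd γ w z t ω) * inner ℝ (v i) (sgd γ w z k ω)) P :=
      fun t k => (hmem t).integrable_mul (hmem k)
    simp only [hω]
    rw [integral_const_mul, integral_finsetSum _ fun t _ => integrable_finsetSum _ fun k _ =>
      hi t k]
    simp only [integral_finsetSum _ fun k _ => hi _ k]
  rw [hsq]
  rw [sub_sub_cancel] at key
  calc _ = 1 / (γ * (N : ℝ) ^ 2) * (γ * lam i * ∑ t ∈ Finset.Ico s (s + N),
        ∑ k ∈ Finset.Ico s (s + N),
        ∫ ω, inner ℝ (v i) (sgd γ w z t ω) * inner ℝ (v i) (sgd γ w z k ω) ∂P) := by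
        field_simp
    _ ≤ 1 / (γ * (N : ℝ) ^ 2) * _ := mul_le_mul_of_nonneg_left key (by positivity)
    _ = _ := by ring

end Moments

end CenteredModel

end SGDRegression

/-! ### Bounds for the variance and the bias of the average. -/

namespace SGDRegression

lemma tsum_le_sum_add_tsum_of_le {f a b : ℕ → ℝ} {S : ℝ} (hf : HasSum f S) (k : ℕ)
    (hb : Summable b) (ha : ∀ i < k, f i ≤ a i) (hfb : ∀ i, k ≤ i → f i ≤ b i) :
    S ≤ ∑ i ∈ Finset.range k, a i + ∑' j, b (k + j) := by
  rw [← hf.tsum_eq, ← hf.summable.sum_add_tsum_nat_add k]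
  refine add_le_add (Finset.sum_le_sum fun i hi => ha i (Finset.mem_range.1 hi)) ?_
  simp only [add_comm _ k]
  refine Summable.tsum_le_tsum (fun j => hfb _ (by omega)) ?_ ?_
  · simpa only [add_comm _ k] using (summable_nat_add_iff k).2 hf.summable
  · simpa only [add_comm _ k] using (summable_nat_add_iff k).2 hb

lemma summable_sq_of_antitone {lam : ℕ → ℝ} (ha : Antitone lam) (h0 : ∀ i, 0 ≤ lam i)
    (hs : Summable lam) : Summable fun i => lam i ^ 2 := by
  refine Summable.of_nonneg_of_le (fun i => sq_nonneg _) (fun i => ?_) (hs.mul_left (lam 0))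
  rw [sq]
  exact mul_le_mul_of_nonneg_right (ha (Nat.zero_le i)) (h0 i)

variable {E : Type*} [NormedAddCommGroup E] [InnerProductSpace ℝ E] [CompleteSpace E]
  [SecondCountableTopology E] [MeasurableSpace E] [BorelSpace E]
  {Ω : Type*} [MeasurableSpace Ω] {P : Measure Ω} [IsProbabilityMeasure P]
  {D : Measure (E × ℝ)} [IsProbabilityMeasure D] {z : ℕ → Ω → E × ℝ}
  {H : E →L[ℝ] E} {lam : ℕ → ℝ} {v : ℕ → E} {α σsq : ℝ}

namespace CenteredModel

lemma inner_eigenvector_pow (h : CenteredModel D H lam v α σsq) (γ : ℝ) (i s : ℕ) (w : E) :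
    inner ℝ (v i) (((1 - γ • H) ^ s) w) = (1 - γ * lam i) ^ s * inner ℝ (v i) w := by
  induction s with
  | zero => simp
  | succ s ih =>
    rw [pow_succ', mul_apply_eq_comp]
    simp only [_root_.sub_apply, _root_.smul_apply,
      one_apply_eq_self, inner_sub_right, inner_smul_right, h.inner_eigenvector_map, ih]
    ring

section Bounds

variable (h : CenteredModel D H lam v α σsq) (hlaw : ∀ t, HasLaw (z t) D P)
    (hindep : iIndepFun z P) {γ : ℝ} (hγ : 0 < γ) (hγlam : ∀ i, γ * lam i ≤ 1)

include h hlaw hindep hγ hγlam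

/-- Adding `(γλ_i)² q_i` to the right completes the square, replacing the possibly negative factor
`1 - 2γλ_i` by a square. -/
lemma integral_sq_sgd_succ_le_contraction {w : E} (hnoise : w = 0 ∨ ∀ᵐ p ∂D, p.2 = 0) (i t : ℕ) :
    ∫ ω, inner ℝ (v i) (sgd γ w z (t + 1) ω) ^ 2 ∂P
      ≤ (1 - γ * lam i) ^ 2 * ∫ ω, inner ℝ (v i) (sgd γ w z t ω) ^ 2 ∂P
        + γ ^ 2 * lam i * (α * ∫ ω, inner ℝ (sgd γ w z t ω) (H (sgd γ w z t ω)) ∂P + σsq) := by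
  have h1 := h.integral_sq_sgd_succ_le hlaw hindep γ w hnoise i t
  have h2 : 0 ≤ ∫ ω, inner ℝ (v i) (sgd γ w z t ω) ^ 2 ∂P := integral_nonneg fun ω => sq_nonneg _
  have h3 := mul_nonneg (sq_nonneg (γ * lam i)) h2
  nlinarith

/-- The second moments of the coordinates of the iterates that start at the minimizer. -/
lemma integral_sq_sgd_of_zero_le {c : ℝ} (hα0 : 0 ≤ α)
    (hc : c * (γ * α * ∑' i, lam i) + γ * σsq ≤ c) (hc0 : 0 ≤ c) (t i : ℕ) :
    ∫ ω, inner ℝ (v i) (sgd γ 0 z t ω) ^ 2 ∂P ≤ c ∧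
    ∫ ω, inner ℝ (v i) (sgd γ 0 z t ω) ^ 2 ∂P ≤ c * (γ * lam i * t) := by
  induction t generalizing i with
  | zero => simp [sgd, hc0]
  | succ t ih =>
    have hlam := h.eigenvalue_nonneg
    set τ := ∫ ω, inner ℝ (sgd γ 0 z t ω) (H (sgd γ 0 z t ω)) ∂P with hτ
    -- The coupling term uses the uniform bound in all coordinates at once, so the induction on `t`
    -- keeps `i` free.
    have hτle : τ ≤ c * ∑' i, lam i := by
      refine hasSum_le (fun i => ?_)
        (h.hasSum_integral_quadratic hlaw hindep (h.memLp_sgd hlaw hindep γ 0 t))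
        (h.hasSum_eigenvalue.summable.hasSum.mul_left c)
      rw [mul_comm c]
      exact mul_le_mul_of_nonneg_left (ih i).1 (hlam i)
    have hrec := h.integral_sq_sgd_succ_le_contraction hlaw hindep hγ hγlam (w := 0)
      (Or.inl rfl) i t
    rw [← hτ] at hrec
    set q := ∫ ω, inner ℝ (v i) (sgd γ 0 z t ω) ^ 2 ∂P
    have hq0 : 0 ≤ q := integral_nonneg fun ω => sq_nonneg _
    have hl : 0 ≤ γ * lam i := mul_nonneg hγ.le (hlam i)
    have hnoise : γ ^ 2 * lam i * (α * τ + σsq) ≤ γ * lam i * c := by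
      have h1 : γ * (α * τ + σsq) ≤ c := by
        have := mul_le_mul_of_nonneg_left hτle (mul_nonneg hγ.le hα0)
        linarith
      calc _ = γ * lam i * (γ * (α * τ + σsq)) := by ring
        _ ≤ _ := mul_le_mul_of_nonneg_left h1 hl
    obtain ⟨ih1, ih2⟩ := ih i
    have h1 := hγlam i
    constructor
    -- The slack in `(1 - γλ_i)² c + γλ_i c ≤ c` is `c γλ_i (1 - γλ_i)`.
    · have := mul_le_mul_of_nonneg_left ih1 (sq_nonneg (1 - γ * lam i))
      have := mul_nonneg hc0 (mul_nonneg hl (sub_nonneg.2 h1))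
      nlinarith
    · have h2 : (1 - γ * lam i) ^ 2 ≤ 1 := pow_le_one₀ (by linarith) (by linarith)
      have := mul_le_mul_of_nonneg_right h2 hq0
      push_cast
      linarith

/-- The variance of the average. -/
lemma integral_quadratic_tailAverage_le_of_zero {c : ℝ} (hα0 : 0 ≤ α)
    (hc : c * (γ * α * ∑' i, lam i) + γ * σsq ≤ c) (hc0 : 0 ≤ c) (s : ℕ) {N : ℕ} (hN : 0 < N) :
    ∫ ω, inner ℝ (tailAverage γ 0 z s N ω) (H (tailAverage γ 0 z s N ω)) ∂P
      ≤ 2 * (c / γ * (cutoff lam (1 / (γ * N)) / (N : ℝ)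
        + γ * ∑ i ∈ Finset.Ico (cutoff lam (1 / (γ * N))) (cutoff lam (1 / (γ * ((s : ℝ) + N)))),
            lam i
        + γ ^ 2 * ((s : ℝ) + N) *
            ∑' j, lam (cutoff lam (1 / (γ * ((s : ℝ) + N))) + j) ^ 2)) := by
  have hN' : (0 : ℝ) < N := by exact_mod_cast hN
  have hlam := h.eigenvalue_nonneg
  have hsumm := h.hasSum_eigenvalue.summable
  have hsq := summable_sq_of_antitone h.eigen.antitone hlam hsumm
  set k := cutoff lam (1 / (γ * N)) with hk
  set d := cutoff lam (1 / (γ * ((s : ℝ) + N))) with hd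
  have hkd : k ≤ d := by
    refine cutoff_anti h.eigen.antitone hsumm (by positivity) ?_
    gcongr
    simp
  set A : ℕ → ℝ := fun i =>
    ∑ t ∈ Finset.Ico s (s + N), ∫ ω, inner ℝ (v i) (sgd γ 0 z t ω) ^ 2 ∂P with hA
  have hA1 : ∀ i, A i ≤ N * c := fun i => by
    have := Finset.sum_le_card_nsmul (Finset.Ico s (s + N)) _ c fun t _ =>
      (h.integral_sq_sgd_of_zero_le hlaw hindep hγ hγlam hα0 hc hc0 t i).1
    rwa [nsmul_eq_mul, Nat.card_Ico, Nat.add_sub_cancel_left] at this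
  have hA2 : ∀ i, A i ≤ N * (c * (γ * lam i * ((s : ℝ) + N))) := fun i => by
    have := Finset.sum_le_card_nsmul (Finset.Ico s (s + N)) _ (c * (γ * lam i * ((s : ℝ) + N)))
      fun t ht => (h.integral_sq_sgd_of_zero_le hlaw hindep hγ hγlam hα0 hc hc0 t i).2.trans ?_
    · rwa [nsmul_eq_mul, Nat.card_Ico, Nat.add_sub_cancel_left] at this
    · have h1 : (t : ℝ) ≤ (s : ℝ) + N := by exact_mod_cast (Finset.mem_Ico.1 ht).2.le
      have := hlam i
      gcongr
  have hA0 : ∀ i, 0 ≤ A i :=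
    fun i => Finset.sum_nonneg fun t _ => integral_nonneg fun ω => sq_nonneg _
  have hr0 : ∀ i, 0 ≤ 1 - γ * lam i := fun i => by linarith [hγlam i]
  have hcoord := fun i =>
    h.eigenvalue_mul_integral_sq_tailAverage_le hlaw hindep γ 0 hγ (hγlam i) s N
  have hB : ∀ i, 1 - (1 - γ * lam i) ^ N ≤ N * (γ * lam i) := fun i => by
    simpa using one_sub_pow_le_mul (hr0 i) N
  -- Three regimes: below `k`, use `1 - (1 - γλ_i)^N ≤ 1` and `q_i ≤ c`; between `k` and `d`, use
  -- `Nγλ_i` and `q_i ≤ c`; from `d` on, use `Nγλ_i` and the bound on `q_i` linear in time.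
  have main := tsum_le_sum_add_tsum_of_le
    (h.hasSum_integral_quadratic hlaw hindep (h.memLp_tailAverage hlaw hindep γ 0 s N)) d
    (a := fun i => if i < k then 2 * c / (γ * N) else 2 * c * lam i)
    (b := fun i => 2 * c * γ * ((s : ℝ) + N) * lam i ^ 2)
    (hsq.mul_left _) (fun i hi => ?_) (fun i hi => ?_)
  · refine main.trans_eq ?_
    rw [tsum_mul_left, ← Finset.sum_range_add_sum_Ico _ hkd,
      Finset.sum_congr rfl fun i hi => if_pos (Finset.mem_range.1 hi),
      Finset.sum_congr rfl fun i (hi : i ∈ Finset.Ico k d) =>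
        if_neg (not_lt.2 (Finset.mem_Ico.1 hi).1), ← Finset.mul_sum]
    simp only [Finset.sum_const, Finset.card_range, nsmul_eq_mul]
    field_simp
  · refine (hcoord i).trans ?_
    have h0 := hA0 i
    have h2 := hA1 i
    split_ifs with hik
    · have h1 := one_sub_pow_le_one (hr0 i) N
      calc _ ≤ 2 / (γ * (N : ℝ) ^ 2) * 1 * (N * c) := by gcongr
        _ = _ := by field_simp
    · have h1 := hB i
      have := hlam i
      calc _ ≤ 2 / (γ * (N : ℝ) ^ 2) * (N * (γ * lam i)) * (N * c) := by gcongr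
        _ = _ := by field_simp
  · refine (hcoord i).trans ?_
    have h0 := hA0 i
    have h1 := hB i
    have h2 := hA2 i
    have := hlam i
    calc _ ≤ 2 / (γ * (N : ℝ) ^ 2) * (N * (γ * lam i))
          * (N * (c * (γ * lam i * ((s : ℝ) + N)))) := by gcongr
      _ = _ := by field_simp

end Bounds

section Noiseless

variable (h : CenteredModel D H lam v α 0) (hlaw : ∀ t, HasLaw (z t) D P)
    (hindep : iIndepFun z P) {γ : ℝ} (hγ : 0 < γ) (hγlam : ∀ i, γ * lam i ≤ 1)

include h hlaw hindep hγ hγlam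

/-- Without noise, the excess risks of the iterates are summable. -/
lemma sum_integral_quadratic_sgd_le (hα : γ * α * ∑' i, lam i ≤ 1) (w : E)
    (hnoise : ∀ᵐ p ∂D, p.2 = 0) (t : ℕ) :
    ∑ u ∈ Finset.range t, ∫ ω, inner ℝ (sgd γ w z u ω) (H (sgd γ w z u ω)) ∂P ≤ ‖w‖ ^ 2 / γ := by
  -- Summing the uncompleted recursion over coordinates gives drift `-2γτ + γ²α(tr H)τ`, and the
  -- stepsize condition makes this at most `-γτ`.
  have hstep : ∀ t, ∫ ω, ‖sgd γ w z (t + 1) ω‖ ^ 2 ∂P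
      + γ * ∫ ω, inner ℝ (sgd γ w z t ω) (H (sgd γ w z t ω)) ∂P
      ≤ ∫ ω, ‖sgd γ w z t ω‖ ^ 2 ∂P := by
    intro t
    have hm := h.memLp_sgd hlaw hindep γ w t
    set τ := ∫ ω, inner ℝ (sgd γ w z t ω) (H (sgd γ w z t ω)) ∂P with hτ
    have hτ0 : 0 ≤ τ := integral_nonneg fun ω => h.quadratic_nonneg _
    have hs := h.hasSum_eigenvalue
    have hsum := ((h.hasSum_integral_sq_inner hlaw hindep hm).sub
      ((h.hasSum_integral_quadratic hlaw hindep hm).mul_left (2 * γ))).add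
      (hs.mul_left (γ ^ 2 * (α * τ)))
    have := hasSum_le (fun i => ?_)
      (h.hasSum_integral_sq_inner hlaw hindep (h.memLp_sgd hlaw hindep γ w (t + 1))) hsum
    · rw [hs.tsum_eq] at hα
      have h5 := mul_le_mul_of_nonneg_left hα (mul_nonneg hγ.le hτ0)
      rw [← hτ] at this
      nlinarith
    · refine (h.integral_sq_sgd_succ_le hlaw hindep γ w (Or.inr hnoise) i t).trans_eq ?_
      ring
  have htel : γ * ∑ u ∈ Finset.range t, ∫ ω, inner ℝ (sgd γ w z u ω) (H (sgd γ w z u ω)) ∂P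
      + ∫ ω, ‖sgd γ w z t ω‖ ^ 2 ∂P ≤ ‖w‖ ^ 2 := by
    induction t with
    | zero => simp [sgd]
    | succ t ih =>
      rw [Finset.sum_range_succ]
      linarith [hstep t]
  rw [le_div_iff₀ hγ]
  have : 0 ≤ ∫ ω, ‖sgd γ w z t ω‖ ^ 2 ∂P := integral_nonneg fun ω => sq_nonneg _
  linarith

/-- The bias of the average. -/
lemma integral_quadratic_tailAverage_le_of_noiseless (hα0 : 0 ≤ α)
    (hα : γ * α * ∑' i, lam i ≤ 1) (w : E) (hnoise : ∀ᵐ p ∂D, p.2 = 0)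
    (s : ℕ) {N : ℕ} (hN : 0 < N) :
    ∫ ω, inner ℝ (tailAverage γ w z s N ω) (H (tailAverage γ w z s N ω)) ∂P
      ≤ 2 * effectiveBias H lam v γ s N w
        + 2 * (α * γ * ‖w‖ ^ 2 * (cutoff lam (1 / (γ * N)) / ((N : ℝ) ^ 2 * γ ^ 2)
          + ∑' j, lam (cutoff lam (1 / (γ * N)) + j) ^ 2)) := by
  have hN' : (0 : ℝ) < N := by exact_mod_cast hN
  set k := cutoff lam (1 / (γ * N)) with hk
  set b : ℕ → ℝ := fun i => inner ℝ (v i) (((1 - γ • H) ^ s) w) ^ 2 with hb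
  have hlam := h.eigenvalue_nonneg
  have hsumm := h.hasSum_eigenvalue.summable
  have hsq := summable_sq_of_antitone h.eigen.antitone hlam hsumm
  have hbs : Summable fun i => lam i * b i := (h.hasSum_quadratic _).summable
  have hwin : ∀ i, ∑ t ∈ Finset.Ico s (s + N), ∫ ω, inner ℝ (v i) (sgd γ w z t ω) ^ 2 ∂P
        ≤ N * (b i + γ * α * lam i * ‖w‖ ^ 2) ∧
      γ * lam i * ∑ t ∈ Finset.Ico s (s + N), ∫ ω, inner ℝ (v i) (sgd γ w z t ω) ^ 2 ∂P
        ≤ b i + γ * α * lam i * ‖w‖ ^ 2 := by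
    intro i
    have := window_le_of_recursion (r := 1 - γ * lam i) (T := γ * α * lam i * ‖w‖ ^ 2)
      (by linarith [hγlam i]) (by linarith [mul_nonneg hγ.le (hlam i)])
      (q := fun t => ∫ ω, inner ℝ (v i) (sgd γ w z t ω) ^ 2 ∂P)
      (g := fun t => γ ^ 2 * lam i *
        (α * ∫ ω, inner ℝ (sgd γ w z t ω) (H (sgd γ w z t ω)) ∂P + 0))
      (fun t => integral_nonneg fun ω => sq_nonneg _)
      (fun t => mul_nonneg (mul_nonneg (sq_nonneg γ) (hlam i))
        (by simpa using mul_nonneg hα0 (integral_nonneg fun ω => h.quadratic_nonneg _)))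
      (fun t => h.integral_sq_sgd_succ_le_contraction hlaw hindep hγ hγlam (Or.inr hnoise) i t)
      (fun t => ?_) s N
    · have h0 : ((1 - γ * lam i) ^ s) ^ 2 * ∫ ω, inner ℝ (v i) (sgd γ w z 0 ω) ^ 2 ∂P = b i := by
        simp only [hb, h.inner_eigenvector_pow, sgd, mul_pow]
        simp
      rw [h0, sub_sub_cancel] at this
      exact this
    · have h1 := h.sum_integral_quadratic_sgd_le hlaw hindep hγ hγlam hα w hnoise t
      simp only [add_zero]
      rw [← Finset.mul_sum, ← Finset.mul_sum]
      calc _ ≤ γ ^ 2 * lam i * (α * (‖w‖ ^ 2 / γ)) := by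
            have := hlam i
            gcongr
        _ = _ := by field_simp
  have hA0 : ∀ i, 0 ≤ ∑ t ∈ Finset.Ico s (s + N), ∫ ω, inner ℝ (v i) (sgd γ w z t ω) ^ 2 ∂P :=
    fun i => Finset.sum_nonneg fun t _ => integral_nonneg fun ω => sq_nonneg _
  have hr0 : ∀ i, 0 ≤ 1 - γ * lam i := fun i => by linarith [hγlam i]
  have hcoord := fun i =>
    h.eigenvalue_mul_integral_sq_tailAverage_le hlaw hindep γ w hγ (hγlam i) s N
  -- Below `k` the window bound without the factor `N` is paired with `1 - (1 - γλ_i)^N ≤ 1`; beyond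
  -- `k`, the bound with `N` is paired with `Nγλ_i`.
  have main := tsum_le_sum_add_tsum_of_le
    (h.hasSum_integral_quadratic hlaw hindep (h.memLp_tailAverage hlaw hindep γ w s N)) k
    (a := fun i => 2 / (γ ^ 2 * (N : ℝ) ^ 2) * (b i / lam i + γ * α * ‖w‖ ^ 2))
    (b := fun i => 2 * (lam i * b i + γ * α * ‖w‖ ^ 2 * lam i ^ 2))
    ((hbs.add (hsq.mul_left _)).mul_left 2) (fun i hi => ?_) (fun i hi => ?_)
  · refine main.trans_eq ?_
    have t1 := (summable_nat_add_iff k).2 hbs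
    have t2 := (summable_nat_add_iff k).2 hsq
    simp only [add_comm _ k] at t1 t2
    rw [tsum_mul_left, t1.tsum_add (t2.mul_left _), tsum_mul_left, ← Finset.mul_sum,
      Finset.sum_add_distrib]
    simp only [effectiveBias, headInvNormSq, tailNormSq, ← hk, Finset.sum_const, Finset.card_range,
      nsmul_eq_mul, hb]
    field_simp
    ring
  · have hlpos : 0 < lam i := lt_of_lt_of_le (by positivity) (le_of_lt_cutoff h.eigen.antitone hi)
    refine (hcoord i).trans ?_
    have h1 := one_sub_pow_le_one (hr0 i) N
    have h2 := (hwin i).2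
    calc _ ≤ 2 / (γ * (N : ℝ) ^ 2) * 1 * ((b i + γ * α * lam i * ‖w‖ ^ 2) / (γ * lam i)) := by
          have h3 : ∑ t ∈ Finset.Ico s (s + N), ∫ ω, inner ℝ (v i) (sgd γ w z t ω) ^ 2 ∂P
              ≤ (b i + γ * α * lam i * ‖w‖ ^ 2) / (γ * lam i) := by
            rw [le_div_iff₀ (by positivity)]
            linarith
          have := hA0 i
          gcongr
      _ = _ := by field_simp
  · refine (hcoord i).trans ?_
    have h1 := one_sub_pow_le_mul (hr0 i) N
    rw [sub_sub_cancel] at h1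
    have h2 := (hwin i).1
    calc _ ≤ 2 / (γ * (N : ℝ) ^ 2) * (N * (γ * lam i))
            * (N * (b i + γ * α * lam i * ‖w‖ ^ 2)) := by
          have := hA0 i
          have := hlam i
          gcongr
      _ = _ := by field_simp

end Noiseless

end CenteredModel

end SGDRegression

/-! ### Reduction of the regression problem to centered models. -/

namespace SGDRegression

variable {E : Type*} [NormedAddCommGroup E] [InnerProductSpace ℝ E] [CompleteSpace E]
  [SecondCountableTopology E] [MeasurableSpace E] [BorelSpace E]
  {D : Measure (E × ℝ)} [IsProbabilityMeasure D]

lemma inner_integral_apply {T : E × ℝ → E →L[ℝ] E} (hT : Integrable T D) (u w : E) :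
    inner ℝ u ((∫ p, T p ∂D) w) = ∫ p, inner ℝ u (T p w) ∂D := by
  rw [ContinuousLinearMap.integral_apply hT, integral_inner (hT.apply_continuousLinearMap w)]

lemma continuous_rankOne_self : Continuous fun x : E => rankOne ℝ x x := by
  have h : (fun x : E => rankOne ℝ x x)
      = fun x => ContinuousLinearMap.smulRightL ℝ E E (innerSL ℝ x) x := rfl
  rw [h]
  fun_prop

section Moments

variable (hx : MemLp (fun p : E × ℝ => p.1) 4 D)

include hx

lemma inner_secondMoment (u w : E) :
    inner ℝ u (secondMoment D w) = ∫ p, inner ℝ u p.1 * inner ℝ w p.1 ∂D := by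
  have hint : Integrable (fun p : E × ℝ => rankOne ℝ p.1 p.1) D := by
    have h2 : Integrable (fun p : E × ℝ => ‖p.1‖ ^ 2) D :=
      (hx.mono_exponent (q := 4) (p := 2) (by norm_num)).integrable_norm_pow two_ne_zero
    have := secondCountableTopologyEither_of_left (E × ℝ) (E →L[ℝ] E)
    refine h2.mono' (continuous_rankOne_self.comp continuous_fst).aestronglyMeasurable
      (.of_forall fun p => ?_)
    simp [sq]
  rw [secondMoment, inner_integral_apply hint]
  congr 1
  ext p
  rw [rankOne_apply, inner_smul_right, real_inner_comm w, mul_comm]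

/-- Only rank one operators `A = e eᵀ` are ever inserted in the fourth moment condition; then
`tr(HA) = ⟨e, H e⟩`. -/
lemma inner_fourthMoment_rankOne (e u : E) :
    inner ℝ u (fourthMoment D (rankOne ℝ e e) u)
      = ∫ p, (inner ℝ e p.1 * inner ℝ u p.1) ^ 2 ∂D := by
  have hint : Integrable (fun p : E × ℝ =>
      (rankOne ℝ p.1 p.1) ∘L (rankOne ℝ e e) ∘L (rankOne ℝ p.1 p.1)) D := by
    have h4 : Integrable (fun p : E × ℝ => ‖p.1‖ ^ 4) D := by
      simpa using hx.integrable_norm_pow (by norm_num)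
    have := secondCountableTopologyEither_of_left (E × ℝ) (E →L[ℝ] E)
    have hc := continuous_rankOne_self.comp (continuous_fst (X := E) (Y := ℝ))
    refine (h4.const_mul (‖e‖ ^ 2)).mono'
      (hc.clm_comp (continuous_const.clm_comp hc)).aestronglyMeasurable
      (.of_forall fun p => ?_)
    refine (ContinuousLinearMap.opNorm_comp_le _ _).trans ?_
    calc _ ≤ ‖rankOne ℝ p.1 p.1‖ * (‖rankOne ℝ e e‖ * ‖rankOne ℝ p.1 p.1‖) := by
          gcongr
          exact ContinuousLinearMap.opNorm_comp_le _ _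
      _ = _ := by simp only [norm_rankOne]; ring
  rw [fourthMoment, inner_integral_apply hint]
  congr 1
  ext p
  simp only [ContinuousLinearMap.comp_apply, rankOne_apply, inner_smul_right]
  rw [real_inner_comm u p.1, real_inner_comm e p.1]
  ring

end Moments

lemma opTrace_comp_rankOne (T : E →L[ℝ] E) (e : E) :
    opTrace (T ∘L rankOne ℝ e e) = inner ℝ e (T e) := by
  set b := (exists_hilbertBasis ℝ E).choose_spec.choose
  rw [← b.tsum_inner_mul_inner e (T e)]
  refine tsum_congr fun i => ?_
  simp only [ContinuousLinearMap.comp_apply, rankOne_apply, map_smul, inner_smul_right]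
  rfl

/-- The trace is the sum of the eigenvalues. -/
lemma CenteredModel.opTrace_eq {H : E →L[ℝ] E} {lam : ℕ → ℝ} {v : ℕ → E} {α σsq : ℝ}
    (h : CenteredModel D H lam v α σsq) : opTrace H = ∑' i, lam i := by
  set b := (exists_hilbertBasis ℝ E).choose_spec.choose
  have hlam := h.eigenvalue_nonneg
  have hrow : ∀ i, HasSum (fun j => lam i * inner ℝ (v i) (b j) ^ 2) (lam i) := by
    intro i
    have h1 := (b.hasSum_inner_mul_inner (v i) (v i)).mul_left (lam i)
    have h2 : lam i * inner ℝ (v i) (v i) = lam i := by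
      rw [real_inner_self_eq_norm_sq]
      rcases h.eigen.normalized i with h1 | h1 <;> simp [h1]
    rw [h2] at h1
    convert! h1 using 3 with j
    rw [sq, real_inner_comm (v i) (b j)]
  have hsum : Summable (Function.uncurry fun i j => lam i * inner ℝ (v i) (b j) ^ 2) := by
    refine (summable_prod_of_nonneg fun q => mul_nonneg (hlam _) (sq_nonneg _)).2
      ⟨fun i => (hrow i).summable, ?_⟩
    simpa only [Function.uncurry, (hrow _).tsum_eq] using h.hasSum_eigenvalue.summable
  calc opTrace H = ∑' j, ∑' i, lam i * inner ℝ (v i) (b j) ^ 2 := by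
        rw [opTrace]
        congr 1
        ext j
        exact (h.hasSum_quadratic (b j)).tsum_eq.symm
    _ = ∑' i, ∑' j, lam i * inner ℝ (v i) (b j) ^ 2 := hsum.tsum_comm
    _ = ∑' i, lam i := by simp only [(hrow _).tsum_eq]

section Risk

variable {wstar : E} (hreg : RegularityConditions D wstar)

include hreg

lemma RegularityConditions.memLp_inner (u : E) :
    MemLp (fun p : E × ℝ => inner ℝ u p.1) 2 D :=
  (hreg.memLp_fst.mono_exponent (by norm_num)).const_inner u

lemma RegularityConditions.memLp_residual :
    MemLp (fun p : E × ℝ => p.2 - inner ℝ wstar p.1) 2 D :=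
  hreg.memLp_snd.sub (hreg.memLp_inner wstar)

lemma RegularityConditions.risk_add (u : E) :
    risk D (wstar + u) = risk D wstar
      - ∫ p, (p.2 - inner ℝ wstar p.1) * inner ℝ u p.1 ∂D
      + 1 / 2 * inner ℝ u (secondMoment D u) := by
  have hξ := hreg.memLp_residual
  have hu := hreg.memLp_inner u
  have i1 := hξ.integrable_sq
  have i2 : Integrable (fun p : E × ℝ => (p.2 - inner ℝ wstar p.1) * inner ℝ u p.1) D :=
    hξ.integrable_mul hu
  have i3 := hu.integrable_sq
  have hp : ∀ p : E × ℝ, (p.2 - inner ℝ (wstar + u) p.1) ^ 2 = (p.2 - inner ℝ wstar p.1) ^ 2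
      + (-2) * ((p.2 - inner ℝ wstar p.1) * inner ℝ u p.1) + inner ℝ u p.1 ^ 2 := by
    intro p
    rw [inner_add_left]
    ring
  rw [risk, risk, inner_secondMoment hreg.memLp_fst]
  simp only [hp, ← sq]
  rw [integral_add (i1.fun_add (i2.const_mul _)) i3, integral_add i1 (i2.const_mul _),
    integral_const_mul]
  ring

/-- The first order optimality condition. -/
lemma RegularityConditions.integral_residual_mul_inner (u : E) :
    ∫ p, (p.2 - inner ℝ wstar p.1) * inner ℝ u p.1 ∂D = 0 := by
  set a := ∫ p, (p.2 - inner ℝ wstar p.1) * inner ℝ u p.1 ∂D with ha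
  set b := inner ℝ u (secondMoment D u) with hb
  have hb0 : 0 ≤ b := by
    rw [hb, inner_secondMoment hreg.memLp_fst]
    exact integral_nonneg fun p => mul_self_nonneg _
  have key : ∀ t : ℝ, t * a ≤ t ^ 2 / 2 * b := by
    intro t
    have h1 := hreg.minimizer (wstar + t • u)
    rw [hreg.risk_add] at h1
    simp only [inner_smul_left, inner_smul_right, map_smul, conj_trivial, mul_left_comm _ t,
      integral_const_mul] at h1
    rw [← ha, ← hb] at h1
    linarith
  -- Nearly the optimal `t = a / b`, with `b + 1` to allow `b = 0`; it bounds `a² / (b + 1)` by half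
  -- of itself.
  have h1 := key (a / (b + 1))
  have h2 : a / (b + 1) * a = a ^ 2 / (b + 1) := by ring
  have h3 : (a / (b + 1)) ^ 2 / 2 * b = a ^ 2 / (b + 1) * (b / (2 * (b + 1))) := by
    field_simp
  rw [h2, h3] at h1
  have h4 : b / (2 * (b + 1)) ≤ 1 / 2 := by
    rw [div_le_div_iff₀ (by positivity) (by norm_num)]
    linarith
  have h5 : 0 ≤ a ^ 2 / (b + 1) := by positivity
  have h6 : a ^ 2 / (b + 1) = 0 := by nlinarith
  have h7 : b + 1 ≠ 0 := by positivity
  simpa [h7] using h6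

lemma RegularityConditions.risk_eq (w : E) :
    risk D w = risk D wstar + 1 / 2 * inner ℝ (w - wstar) (secondMoment D (w - wstar)) := by
  have := hreg.risk_add (w - wstar)
  rw [hreg.integral_residual_mul_inner, add_sub_cancel] at this
  linarith

variable {α σsq : ℝ} (hfourth : FourthMomentCondition D α) (hnoise : NoiseCondition D wstar σsq)
  {lam : ℕ → ℝ} {v : ℕ → E} (heig : IsEigendecomposition (secondMoment D) lam v)

include hnoise heig in
-- The left side is `⟨R v_i, T R v_i⟩`, and `‖R v_i‖² = λ_i`.
lemma integral_sq_residual_mul_eigenvector_le (i : ℕ) :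
    ∫ p, ((p.2 - inner ℝ wstar p.1) * inner ℝ (v i) p.1) ^ 2 ∂D ≤ σsq * lam i := by
  obtain ⟨hint, R, T, hR, hRR, hRTR, hT⟩ := hnoise
  have h1 : ∫ p, ((p.2 - inner ℝ wstar p.1) * inner ℝ (v i) p.1) ^ 2 ∂D
      = inner ℝ (v i) (noiseCov D wstar (v i)) := by
    rw [noiseCov, inner_integral_apply hint]
    congr 1
    ext p
    simp only [_root_.smul_apply, rankOne_apply, inner_smul_right]
    rw [real_inner_comm (v i) p.1]
    ring
  have hsym : ∀ a b, inner ℝ a (R b) = inner ℝ (R a) b := fun a b => (hR.isSymmetric a b).symm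
  have h2 : ‖R (v i)‖ ^ 2 = lam i := by
    rw [← real_inner_self_eq_norm_sq, ← hsym, ← ContinuousLinearMap.comp_apply, hRR, heig.eigen,
      inner_smul_right, real_inner_self_eq_norm_sq]
    rcases heig.normalized i with h1 | h1 <;> simp [h1]
  rw [h1, ← hRTR, ContinuousLinearMap.comp_apply, ContinuousLinearMap.comp_apply, hsym]
  calc inner ℝ (R (v i)) (T (R (v i))) ≤ ‖R (v i)‖ * ‖T (R (v i))‖ := real_inner_le_norm _ _
    _ ≤ ‖R (v i)‖ * (‖T‖ * ‖R (v i)‖) := by gcongr; exact T.le_opNorm _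
    _ = σsq * lam i := by rw [hT, ← h2]; ring

include hfourth heig in
lemma integral_sq_inner_mul_eigenvector_le (i : ℕ) (e : E) :
    ∫ p, (inner ℝ e p.1 * inner ℝ (v i) p.1) ^ 2 ∂D
      ≤ α * lam i * inner ℝ e (secondMoment D e) := by
  have h1 := hfourth.2 (rankOne ℝ e e) (isPositive_rankOne_self e)
  rw [opTrace_comp_rankOne, ContinuousLinearMap.le_def] at h1
  have h2 := h1.inner_nonneg_right (v i)
  rw [_root_.sub_apply, inner_sub_right, inner_fourthMoment_rankOne hreg.memLp_fst,
    _root_.smul_apply, heig.eigen, inner_smul_right, inner_smul_right,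
    real_inner_self_eq_norm_sq] at h2
  rcases heig.normalized i with h3 | h3
  · rw [h3] at h2
    linarith
  · simp [h3]

include hfourth hnoise heig

/-- The data `(x, c (y - ⟨w*, x⟩))` with `c² ≤ 1` are a centered model. -/
lemma centeredModel_map {c : ℝ} {σ' : ℝ} (hσ' : c ^ 2 * σsq = σ') :
    CenteredModel (D.map fun p : E × ℝ => (p.1, c * (p.2 - inner ℝ wstar p.1))) (secondMoment D)
      lam v α σ' := by
  set G : E × ℝ → E × ℝ := fun p => (p.1, c * (p.2 - inner ℝ wstar p.1)) with hG
  have hGc : Continuous G := by fun_prop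
  have hGm : AEMeasurable G D := hGc.aemeasurable
  have hint : ∀ {f : E × ℝ → ℝ}, Continuous f → ∫ p, f p ∂(D.map G) = ∫ p, f (G p) ∂D :=
    fun hf => integral_map hGm hf.aestronglyMeasurable
  refine ⟨?_, ?_, heig, fun u w => ?_, fun u => ?_, fun i e => ?_, fun i => ?_⟩
  · rw [memLp_map_measure_iff continuous_fst.aestronglyMeasurable hGm]
    exact hreg.memLp_fst
  · rw [memLp_map_measure_iff (Continuous.aestronglyMeasurable (by fun_prop)) hGm]
    -- The integrand of `Σ` has norm `‖ξ x‖²`, so the existence of `Σ` says precisely that `ξ x` is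
    -- square integrable.
    have h1 : MemLp (fun p : E × ℝ => (p.2 - inner ℝ wstar p.1) • p.1) 2 D := by
      rw [memLp_two_iff_integrable_sq_norm (Continuous.aestronglyMeasurable (by fun_prop))]
      refine hnoise.1.norm.congr (.of_forall fun p => ?_)
      simp only [norm_smul, norm_rankOne, norm_pow]
      ring
    convert! h1.const_smul c using 1
    ext1 p
    simp [hG, mul_smul]
  · rw [hint (by fun_prop), inner_secondMoment hreg.memLp_fst]
  · rw [hint (by fun_prop)]
    simp only [hG, mul_assoc, integral_const_mul, hreg.integral_residual_mul_inner, mul_zero]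
  · rw [hint (by fun_prop)]
    exact integral_sq_inner_mul_eigenvector_le hreg hfourth heig i e
  · rw [hint (by fun_prop), ← hσ']
    simp only [hG, mul_assoc, mul_pow c, integral_const_mul]
    exact mul_le_mul_of_nonneg_left
      (integral_sq_residual_mul_eigenvector_le hreg hnoise heig i) (sq_nonneg c)

end Risk

lemma sq_integral_le_integral_sq {f : E × ℝ → ℝ} (hf : MemLp f 2 D) :
    (∫ p, f p ∂D) ^ 2 ≤ ∫ p, f p ^ 2 ∂D := by
  have := variance_nonneg f D
  rw [variance_eq_sub hf] at this
  simpa using this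

/-- If `λ_i > 0`, then `λ_i² = (E⟨v_i, x⟩²)² ≤ E⟨v_i, x⟩⁴ ≤ α λ_i²` forces `α ≥ 1`, so `γλ_i ≤ γα tr
H`. -/
lemma CenteredModel.mul_eigenvalue_le {H : E →L[ℝ] E} {lam : ℕ → ℝ} {v : ℕ → E} {α σsq γ : ℝ}
    (h : CenteredModel D H lam v α σsq) (hα : 0 < α) (hγ : 0 < γ)
    (hle : γ * α * ∑' i, lam i ≤ 1) (i : ℕ) : γ * lam i ≤ 1 := by
  rcases (h.eigenvalue_nonneg i).eq_or_lt with h0 | h0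
  · rw [← h0]; simp
  have hα1 : 1 ≤ α := by
    have h1 := sq_integral_le_integral_sq (h.memLp_inner_mul_inner (v i) (v i))
    have h2 := h.fourth_moment i (v i)
    have h3 : inner ℝ (v i) (H (v i)) = lam i := by
      rw [← h.second_moment, ← h.integral_sq_inner_eigenvector i]
      simp only [sq]
    rw [h.second_moment, h3] at h1
    rw [h3] at h2
    by_contra hlt
    nlinarith [mul_pos h0 h0]
  have h1 : lam i ≤ ∑' i, lam i :=
    h.hasSum_eigenvalue.summable.le_tsum i fun j _ => h.eigenvalue_nonneg j
  have h2 : lam i ≤ α * ∑' i, lam i := by nlinarith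
  nlinarith

section Decomposition

variable {Ω : Type*}

/-- The error recursion is linear in the pair of starting point and noise sequence. The factors 0
and 1 let one construction produce both runs. -/
lemma sgd_sub_eq (γ : ℝ) (w₀ wstar : E) (z : ℕ → Ω → E × ℝ) (t : ℕ) (ω : Ω) :
    sgd γ w₀ z t ω - wstar
      = sgd γ (w₀ - wstar) (fun t ω => ((z t ω).1, 0 * ((z t ω).2 - inner ℝ wstar (z t ω).1))) t ω
        + sgd γ 0 (fun t ω => ((z t ω).1, 1 * ((z t ω).2 - inner ℝ wstar (z t ω).1))) t ω := by
  induction t with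
  | zero => simp [sgd]
  | succ t ih =>
    simp only [sgd]
    have h1 : sgd γ w₀ z t ω = sgd γ w₀ z t ω - wstar + wstar := by abel
    rw [h1, ih]
    simp only [inner_add_left]
    module

lemma tailAverage_sub_eq (γ : ℝ) (w₀ wstar : E) (z : ℕ → Ω → E × ℝ) (s : ℕ) {N : ℕ} (hN : 0 < N)
    (ω : Ω) :
    tailAverage γ w₀ z s N ω - wstar
      = tailAverage γ (w₀ - wstar)
          (fun t ω => ((z t ω).1, 0 * ((z t ω).2 - inner ℝ wstar (z t ω).1))) s N ω
        + tailAverage γ 0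
          (fun t ω => ((z t ω).1, 1 * ((z t ω).2 - inner ℝ wstar (z t ω).1))) s N ω := by
  simp only [tailAverage, ← smul_add, ← Finset.sum_add_distrib, ← sgd_sub_eq,
    Finset.sum_sub_distrib, Finset.sum_const, Nat.card_Ico, Nat.add_sub_cancel_left, smul_sub]
  rw [← Nat.cast_smul_eq_nsmul ℝ, smul_smul, one_div_mul_cancel (by positivity), one_smul]

end Decomposition

end SGDRegression

/-! ### Assembly, including the largest stepsize. -/

namespace SGDRegression

lemma ofReal_le_ofReal_div {x y d : ℝ} (h0 : 0 ≤ x) (hxy : x ≤ y) (hd : d ≤ 1) :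
    ENNReal.ofReal x ≤ ENNReal.ofReal y / ENNReal.ofReal d := by
  rcases (h0.trans hxy).eq_or_lt with hy | hy
  · have : x = 0 := by linarith
    simp [this]
  · rcases le_or_gt d 0 with hd0 | hd0
    · rw [ENNReal.ofReal_of_nonpos hd0, ENNReal.div_zero]
      · exact le_top
      · simpa using hy
    · rw [← ENNReal.ofReal_div_of_pos hd0]
      refine ENNReal.ofReal_le_ofReal (hxy.trans ?_)
      rw [le_div_iff₀ hd0]
      nlinarith

/-- The excess risk of tail-averaged SGD is at most the sum of the bias and the variance. -/
lemma integrable_risk_tailAverage_and_le {E : Type*} [NormedAddCommGroup E]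
    [InnerProductSpace ℝ E] [CompleteSpace E] [SecondCountableTopology E] [MeasurableSpace E]
    [BorelSpace E] {D : Measure (E × ℝ)} [IsProbabilityMeasure D]
    {wstar : E} (hreg : RegularityConditions D wstar) {α : ℝ} (hfourth : FourthMomentCondition D α)
    {σsq : ℝ} (hnoise : NoiseCondition D wstar σsq) {lam : ℕ → ℝ} {v : ℕ → E}
    (heig : IsEigendecomposition (secondMoment D) lam v) {γ : ℝ} (hγ : 0 < γ)
    (hle : γ * α * ∑' i, lam i ≤ 1) (s : ℕ) {N : ℕ} (hN : 0 < N) (w₀ : E)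
    {Ω : Type*} [MeasurableSpace Ω] {P : Measure Ω} [IsProbabilityMeasure P]
    {z : ℕ → Ω → E × ℝ} (hlaw : ∀ t, HasLaw (z t) D P) (hindep : iIndepFun z P) :
    Integrable (fun ω => risk D (tailAverage γ w₀ z s N ω)) P ∧
    ∀ c : ℝ, 0 ≤ c → c * (γ * α * ∑' i, lam i) + γ * σsq ≤ c →
      (∫ ω, risk D (tailAverage γ w₀ z s N ω) ∂P) - risk D wstar
        ≤ 2 * effectiveBias (secondMoment D) lam v γ s N (w₀ - wstar)
          + 2 * (α * γ * ‖w₀ - wstar‖ ^ 2 * (cutoff lam (1 / (γ * N)) / ((N : ℝ) ^ 2 * γ ^ 2)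
            + ∑' j, lam (cutoff lam (1 / (γ * N)) + j) ^ 2))
          + 2 * (c / γ * (cutoff lam (1 / (γ * N)) / (N : ℝ)
            + γ * ∑ i ∈ Finset.Ico (cutoff lam (1 / (γ * N)))
                (cutoff lam (1 / (γ * ((s : ℝ) + N)))), lam i
            + γ ^ 2 * ((s : ℝ) + N) *
                ∑' j, lam (cutoff lam (1 / (γ * ((s : ℝ) + N))) + j) ^ 2)) := by
  have hGc : ∀ c : ℝ, Continuous fun p : E × ℝ => (p.1, c * (p.2 - inner ℝ wstar p.1)) :=
    fun c => by fun_prop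
  have hprob : ∀ c : ℝ, IsProbabilityMeasure
      (D.map fun p : E × ℝ => (p.1, c * (p.2 - inner ℝ wstar p.1))) :=
    fun c => Measure.isProbabilityMeasure_map (hGc c).aemeasurable
  have := hprob 0
  have := hprob 1
  have hb := centeredModel_map hreg hfourth hnoise heig (c := 0) (σ' := 0) (by simp)
  have hv := centeredModel_map hreg hfourth hnoise heig (c := 1) (σ' := σsq) (by simp)
  have hlaw' : ∀ (c : ℝ) (t : ℕ), HasLaw
      (fun ω => ((z t ω).1, c * ((z t ω).2 - inner ℝ wstar (z t ω).1)))
      (D.map fun p : E × ℝ => (p.1, c * (p.2 - inner ℝ wstar p.1))) P := fun c t =>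
    HasLaw.fun_comp ⟨(hGc c).aemeasurable, rfl⟩ (hlaw t)
  have hindep' : ∀ c : ℝ, iIndepFun
      (fun t ω => ((z t ω).1, c * ((z t ω).2 - inner ℝ wstar (z t ω).1))) P := fun c =>
    hindep.comp (fun _ p => (p.1, c * (p.2 - inner ℝ wstar p.1))) fun _ => (hGc c).measurable
  have hγlam := hv.mul_eigenvalue_le hfourth.1 hγ hle
  have hnoiseless : ∀ᵐ p ∂(D.map fun p : E × ℝ => (p.1, (0 : ℝ) * (p.2 - inner ℝ wstar p.1))),
      p.2 = 0 := by
    rw [ae_map_iff (hGc 0).aemeasurable (measurableSet_eq_fun measurable_snd measurable_const)]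
    simp
  have hmb := hb.memLp_tailAverage (hlaw' 0) (hindep' 0) γ (w₀ - wstar) s N
  have hmv := hv.memLp_tailAverage (hlaw' 1) (hindep' 1) γ 0 s N
  have hqb := hb.integrable_quadratic (hlaw' 0) (hindep' 0) hmb
  have hqv := hv.integrable_quadratic (hlaw' 1) (hindep' 1) hmv
  have hdecomp := fun ω => tailAverage_sub_eq γ w₀ wstar z s hN ω
  have hqsum := hb.integrable_quadratic (hlaw' 0) (hindep' 0) (hmb.add hmv)
  simp only [Pi.add_apply, ← hdecomp] at hqsum
  have hrisk : (fun ω => risk D (tailAverage γ w₀ z s N ω)) = fun ω => risk D wstar + 1 / 2 *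
      inner ℝ (tailAverage γ w₀ z s N ω - wstar)
        (secondMoment D (tailAverage γ w₀ z s N ω - wstar)) :=
    funext fun ω => hreg.risk_eq _
  refine ⟨?_, fun c hc0 hc => ?_⟩
  · rw [hrisk]
    exact (integrable_const _).add (hqsum.const_mul _)
  have hB := hb.integral_quadratic_tailAverage_le_of_noiseless (hlaw' 0) (hindep' 0) hγ hγlam
    hfourth.1.le hle (w₀ - wstar) hnoiseless s hN
  have hV := hv.integral_quadratic_tailAverage_le_of_zero (hlaw' 1) (hindep' 1) hγ hγlam
    hfourth.1.le hc hc0 s hN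
  rw [hrisk, integral_add (integrable_const _) (hqsum.const_mul _), integral_const_mul]
  -- The factor 2 lost on the cross term is absorbed by the `1 / 2` in the risk.
  have hmono := integral_mono hqsum ((hqb.const_mul 2).fun_add (hqv.const_mul 2)) fun ω => by
    rw [hdecomp]
    exact hb.quadratic_add_le _ _
  rw [integral_add (hqb.const_mul 2) (hqv.const_mul 2), integral_const_mul,
    integral_const_mul] at hmono
  simp only [integral_const, probReal_univ, smul_eq_mul]
  linarith

end SGDRegression

/-- Upper bound on the excess risk of constant stepsize SGD with tail-averaging. -/
theorem theorem5p1 {E : Type*} [NormedAddCommGroup E] [InnerProductSpace ℝ E] [CompleteSpace E]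
    [SecondCountableTopology E] [MeasurableSpace E] [BorelSpace E]
    (D : Measure (E × ℝ)) [IsProbabilityMeasure D]
    (wstar : E) (hreg : SGDRegression.RegularityConditions D wstar)
    (α : ℝ) (hfourth : SGDRegression.FourthMomentCondition D α)
    (σsq : ℝ) (hnoise : SGDRegression.NoiseCondition D wstar σsq)
    (lam : ℕ → ℝ) (v : ℕ → E)
    (heig : SGDRegression.IsEigendecomposition (SGDRegression.secondMoment D) lam v)
    (γ : ℝ) (hγ_pos : 0 < γ)
    (hγ_le : γ ≤ 1 / (α * SGDRegression.opTrace (SGDRegression.secondMoment D)))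
    (s N : ℕ) (hN : 0 < N) (w₀ : E)
    {Ω : Type*} [MeasurableSpace Ω] (P : Measure Ω) [IsProbabilityMeasure P]
    (z : ℕ → Ω → E × ℝ) (hlaw : ∀ t, HasLaw (z t) D P) (hindep : iIndepFun z P) :
    Integrable (fun ω => SGDRegression.risk D (SGDRegression.tailAverage γ w₀ z s N ω)) P ∧
    ENNReal.ofReal
        ((∫ ω, SGDRegression.risk D (SGDRegression.tailAverage γ w₀ z s N ω) ∂P)
          - SGDRegression.risk D wstar)
      ≤ 2 * ENNReal.ofReal (SGDRegression.effectiveBias (SGDRegression.secondMoment D) lam v γ s N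
            (w₀ - wstar))
        + 2 * SGDRegression.effectiveVar (SGDRegression.secondMoment D) lam α σsq γ s N
            (w₀ - wstar) := by
  open SGDRegression in
  have : IsProbabilityMeasure
      (D.map fun p : E × ℝ => (p.1, (1 : ℝ) * (p.2 - inner ℝ wstar p.1))) :=
    Measure.isProbabilityMeasure_map (Continuous.aemeasurable (by fun_prop))
  have hmodel := centeredModel_map hreg hfourth hnoise heig (c := 1) (σ' := σsq) (by simp)
  have hlam := hmodel.eigenvalue_nonneg
  have hsumm := hmodel.hasSum_eigenvalue.summable
  have hsq := summable_sq_of_antitone heig.antitone hlam hsumm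
  have hα := hfourth.1
  rw [hmodel.opTrace_eq] at hγ_le
  -- Since `1 / 0 = 0`, the stepsize bound and `γ > 0` already exclude a zero trace.
  have htr : 0 < ∑' i, lam i := by
    by_contra h0
    have h1 := mul_nonpos_of_nonneg_of_nonpos hα.le (not_lt.1 h0)
    linarith [one_div_nonpos.2 h1]
  have hρ : γ * α * ∑' i, lam i ≤ 1 := by
    rw [le_div_iff₀ (by positivity)] at hγ_le
    linarith
  have hσ : 0 ≤ σsq := by
    obtain ⟨-, R, T, -, -, -, rfl⟩ := hnoise
    exact norm_nonneg T
  obtain ⟨hint, hbound⟩ :=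
    integrable_risk_tailAverage_and_le hreg hfourth hnoise heig hγ_pos hρ s hN w₀ hlaw hindep
  refine ⟨hint, ?_⟩
  have hN' : (0 : ℝ) < N := by exact_mod_cast hN
  rw [effectiveVar, hmodel.opTrace_eq]
  set k := cutoff lam (1 / (γ * N))
  set d := cutoff lam (1 / (γ * ((s : ℝ) + N))) with hd
  set ρ := γ * α * ∑' i, lam i with hρdef
  set V₁ := α * γ * ‖w₀ - wstar‖ ^ 2 * (k / ((N : ℝ) ^ 2 * γ ^ 2) + ∑' j, lam (k + j) ^ 2)
    with hV₁
  set K := k / (N : ℝ) + γ * ∑ i ∈ Finset.Ico k d, lam i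
    + γ ^ 2 * ((s : ℝ) + N) * ∑' j, lam (d + j) ^ 2 with hK
  have htail : ∀ m, 0 ≤ ∑' j, lam (m + j) ^ 2 := fun m => tsum_nonneg fun j => sq_nonneg _
  have hmid : 0 ≤ ∑ i ∈ Finset.Ico k d, lam i := Finset.sum_nonneg fun i _ => hlam i
  have hV₁0 : 0 ≤ V₁ := by
    have := htail k
    positivity
  -- Positivity makes the noise fraction infinite when `1 - ρ = 0` and `σ² > 0`. The term that is
  -- positive depends on which cutoffs vanish.
  have hK0 : 0 < K := by
    have hlam0 : 0 < lam 0 := by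
      refine (hlam 0).lt_of_ne fun h0 => htr.ne' ?_
      have : lam = 0 := funext fun i =>
        le_antisymm ((heig.antitone (Nat.zero_le i)).trans h0.ge) (hlam i)
      simp [this]
    have h1 : 0 < ((s : ℝ) + N) := by positivity
    have h2 := htail d
    rcases Nat.eq_zero_or_pos k with hk | hk
    · rcases Nat.eq_zero_or_pos d with hd0 | hd0
      · have h3 : 0 < ∑' j, lam (d + j) ^ 2 := by
          simp only [hd0, zero_add]
          exact hsq.tsum_pos (fun i => sq_nonneg _) 0 (by positivity)
        positivity
      · have h3 : 0 < ∑ i ∈ Finset.Ico k d, lam i := by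
          refine Finset.sum_pos' (fun i _ => hlam i) ⟨0, ?_, hlam0⟩
          simp [hk, hd0]
        positivity
    · have h3 : (0 : ℝ) < k := by exact_mod_cast hk
      positivity
  -- The bias bound itself has no denominator; both the factor 2 and the division by `1 - ρ` are
  -- slack.
  have hfirst : ENNReal.ofReal V₁ ≤ ENNReal.ofReal (2 * α * γ * ‖w₀ - wstar‖ ^ 2 *
      (k / ((N : ℝ) ^ 2 * γ ^ 2) + ∑' j, lam (k + j) ^ 2)) / ENNReal.ofReal (1 - ρ) := by
    refine ofReal_le_ofReal_div hV₁0 ?_ ?_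
    · rw [show 2 * α * γ * ‖w₀ - wstar‖ ^ 2 * (k / ((N : ℝ) ^ 2 * γ ^ 2) + ∑' j, lam (k + j) ^ 2)
        = 2 * V₁ by rw [hV₁]; ring]
      linarith
    · have : 0 ≤ ρ := by positivity
      linarith
  have hsplit : ∀ V₂ : ℝ, ENNReal.ofReal (2 * effectiveBias (secondMoment D) lam v γ s N
      (w₀ - wstar) + 2 * V₁ + 2 * V₂) ≤ 2 * ENNReal.ofReal (effectiveBias (secondMoment D) lam v γ
      s N (w₀ - wstar)) + 2 * (ENNReal.ofReal V₁ + ENNReal.ofReal V₂) := by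
    intro V₂
    refine ENNReal.ofReal_add_le.trans ?_
    refine (add_le_add ENNReal.ofReal_add_le le_rfl).trans_eq ?_
    simp only [ENNReal.ofReal_mul zero_le_two, ENNReal.ofReal_ofNat]
    ring
  -- For `ρ < 1` the fixed point `c = γσ² / (1 - ρ)` serves. At `ρ = 1` a finite `c` exists only
  -- when `σ² = 0`, and then `c = 0` works; otherwise the right side is infinite.
  suffices hc : ENNReal.ofReal (σsq * K) / ENNReal.ofReal (1 - ρ) = ⊤ ∨ ∃ c, 0 ≤ c ∧
      c * ρ + γ * σsq ≤ c ∧ ENNReal.ofReal (c / γ * K)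
        ≤ ENNReal.ofReal (σsq * K) / ENNReal.ofReal (1 - ρ) by
    rcases hc with htop | ⟨c, hc0, hc, hcK⟩
    · rw [htop]
      simp
    · refine (ENNReal.ofReal_le_ofReal (hbound c hc0 hc)).trans ((hsplit _).trans ?_)
      gcongr
  rcases hρ.lt_or_eq with hlt | heq
  · have h1 : 0 < 1 - ρ := by linarith
    refine Or.inr ⟨γ * σsq / (1 - ρ), by positivity, ?_, ?_⟩
    · refine le_of_eq ?_
      field_simp
      ring
    · rw [← ENNReal.ofReal_div_of_pos h1]
      refine ENNReal.ofReal_le_ofReal (le_of_eq ?_)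
      field_simp
  · rcases hσ.eq_or_lt with h0 | h0
    · exact Or.inr ⟨0, le_rfl, by simp [← h0], by simp⟩
    · refine Or.inl ?_
      rw [heq, sub_self, ENNReal.ofReal_zero]
      refine ENNReal.div_zero ?_
      simpa using mul_pos h0 hK0
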